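/- Let $G$ be a profinite group and $q$ an integer. Let $\mathcal O(G)$ be the set of conjugacy classes $[U]$ of open subgroups of $G$, write $[V]\preceq[U]$ if $U$ is contained in a conjugate of $V$, and in that case put $(V:U)=(G:U)/(G:V)$. For a $G$-space $X$ let $\varphi_U(X)$ be the number of $U$-invariant elements of $X$. For an element $q$ of a commutative ring let $\zeta_G^q$ be the $\mathcal O(G)\times\mathcal O(G)$ matrix with entries $$\zeta_G^q([V],[W])=\varphi_V(G/W)\,q^{(W:V)-1}\ \text{ if }[W]\preceq[V],\qquad \zeta_G^q([V],[W])=0\ \text{ otherwise.}$$ Commutative rings are not required to be unital unless this is said. (1) There is a unique functor $\widehat{Nr}_G^q$ from the category of commutative rings with identity to the category of commutative rings such that: as a set, $\widehat{Nr}_G^q(A)=A^{\mathcal O(G)}$; $\widehat{Nr}_G^q(f)(\mathbf x)=f\circ\mathbf x$ for every homomorphism $f:A\to B$ of rings with identity; and for every $A$ the map $\mathbf x\mapsto\zeta_G^q\,\mathbf x$ is a ring homomorphism from $\widehat{Nr}_G^q(A)$ to the product ring $\prod_{\mathcal O(G)}A$. (2) The addition of $\widehat{Nr}_G^q(A)$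 is componentwise, and $$(\mathbf x\cdot\mathbf y)([U])=\sum_{[V],[W]\preceq[U]}P_{V,W}^U(q)\,\mathbf x([V])\,\mathbf y([W]),$$ where, with $t$ an indeterminate and $\mu_G^t$ the inverse over $\mathbb Q[t]$ of the lower triangular matrix $\zeta_G^t$, $$P_{V,W}^U(t)=\sum_{[V],[W]\preceq[Z]\preceq[U]}\mu_G^t([U],[Z])\,\varphi_Z(G/V)\,\varphi_Z(G/W)\,t^{(V:Z)-1}\,t^{(W:Z)-1}\in\mathbb Q[t],$$ and the value $P_{V,W}^U(q)$ is an integer. (3) For $q=1$ one obtains the classical necklace ring of $G$: the element of $A^{\mathcal O(G)}$ that is $1$ at $[G]$ and $0$ elsewhere is a multiplicative identity, and $(\mathbf x\cdot\mathbf y)([U])=\sum_{[V],[W]}\sum_{VgW}\mathbf x([V])\,\mathbf y([W])$, the inner sum being over the double cosets $VgW\subseteq G$ with $[V\cap gWg^{-1}]=[U]$. (4) An almost finite $G$-space is a discrete space $X$ with a continuous $G$-action for which $X^U$ is finite for every open subgroup $U$. Let $\hat\Omega(G)$ be the Grothendieck group of the isomorphism classes of almost finite $G$-spaces under disjoint union.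 For every open subgroup $U$ let $\varphi_U^q:\hat\Omega(G)\to\mathbb Z$ be the additive map with $$\varphi_U^q([X])=\sum_{x\in X^U}q^{(G_x:U)-1},$$ where $G_x$ is the stabilizer of $x$; thus $\varphi^q_U([G/W])=\varphi_U(G/W)\,q^{(W:U)-1}$ if $[W]\preceq[U]$, and $0$ otherwise. There is a unique commutative ring structure $(\oplus,\otimes)$ on the set $\hat\Omega(G)$ for which all $\varphi_U^q$ are ring homomorphisms to $\mathbb Z$; this ring is the twisted Burnside ring $\hat\Omega^q(G)$. Its addition is that of $\hat\Omega(G)$. There is a ring isomorphism $e:\widehat{Nr}_G^q(\mathbb Z)\to\hat\Omega^q(G)$ that sends the basis vector supported at $[V]$ to $[G/V]$, for every open subgroup $V$, and satisfies $\varphi_U^q(e(\mathbf x))=(\zeta_G^q\mathbf x)([U])$ for all $\mathbf x$ and $U$. If $q\ge1$, then $\varphi_U^q([X])$ is the number of pairs consisting of an $x\in X^U$ and a left $U$-invariant map $G_x\to\mathbb Z/q\mathbb Z$, counted modulo translation of the map by $\mathbb Z/q\mathbb Z$. If $q=1$, then $[X]\otimes[Y]=[X\times Y]$, so that $\hat\Omega^1(G)$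 is the Burnside-Grothendieck ring of $G$. -/

import Mathlib

universe u v

namespace QNecklace

section OpenSubgroups

variable (G : Type u) [Group G] [TopologicalSpace G]

/-- Conjugacy of open subgroups: `g U g⁻¹ = V` for some `g`. -/
def conjSetoid : Setoid (OpenSubgroup G) where
  r U V := ∃ g : G, ∀ x : G, x ∈ U ↔ g * x * g⁻¹ ∈ V
  iseqv :=
    { refl := fun U => ⟨1, fun x => by simp⟩
      symm := by
        rintro U V ⟨g, h⟩
        refine ⟨g⁻¹, fun x => ?_⟩
        rw [h]
        simp [mul_assoc]
      trans := by
        rintro U V W ⟨g, h⟩ ⟨k, h'⟩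
        refine ⟨k * g, fun x => ?_⟩
        rw [h, h']
        simp [mul_assoc] }

/-- `𝒪(G)`: the set of conjugacy classes of open subgroups of `G`. -/
def ConjClass : Type u := Quotient (conjSetoid G)

variable {G}

/-- The conjugacy class `[U]`. -/
def cls (U : OpenSubgroup G) : ConjClass G := Quotient.mk (conjSetoid G) U

/-- A representative of a conjugacy class of open subgroups. -/
noncomputable def ConjClass.rep (c : ConjClass G) : OpenSubgroup G := Quotient.out c

/-- `[V] ⪯ [U]`: the subgroup `U` is contained in some conjugate of `V`. -/
def Prec (V U : ConjClass G) : Prop :=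
  ∃ g : G, ∀ x ∈ U.rep, g * x * g⁻¹ ∈ V.rep

theorem Prec.refl (U : ConjClass G) : Prec U U := ⟨1, fun x hx => by simpa using hx⟩

theorem cls_rep (c : ConjClass G) : cls c.rep = c := Quotient.out_eq c

theorem cls_eq_iff {U V : OpenSubgroup G} :
    cls U = cls V ↔ ∃ g : G, ∀ x : G, x ∈ U ↔ g * x * g⁻¹ ∈ V :=
  Quotient.eq (r := conjSetoid G)

/-- The classes `[V]` with `[V] ⪯ [U]`. -/
abbrev Below (U : ConjClass G) : Type u := {V : ConjClass G // Prec V U}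

/-- `[U]` itself, as an element of `Below [U]`. -/
def Below.top (U : ConjClass G) : Below U := ⟨U, Prec.refl U⟩

/-- `g U g⁻¹`, as an open subgroup. -/
def conjOpen [IsTopologicalGroup G] (g : G) (U : OpenSubgroup G) : OpenSubgroup G :=
  U.comap (MulAut.conj g⁻¹).toMonoidHom (by
    change Continuous fun x : G => g⁻¹ * x * (g⁻¹)⁻¹
    fun_prop)

theorem mem_conjOpen [IsTopologicalGroup G] {g x : G} {U : OpenSubgroup G} :
    x ∈ conjOpen g U ↔ g⁻¹ * x * g ∈ U := by
  change (MulAut.conj g⁻¹) x ∈ U ↔ _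
  simp

theorem finite_above [IsTopologicalGroup G] [CompactSpace G] (U : OpenSubgroup G) :
    Finite {V : OpenSubgroup G // U ≤ V} := by
  have : Finite (G ⧸ U.toSubgroup) := U.toSubgroup.quotient_finite_of_isOpen U.isOpen
  refine Finite.of_injective
    (fun V : {V : OpenSubgroup G // U ≤ V} =>
      ((QuotientGroup.mk : G → G ⧸ U.toSubgroup) '' (V.1 : Set G))) ?_
  have key : ∀ V W : {V : OpenSubgroup G // U ≤ V},
      ((QuotientGroup.mk : G → G ⧸ U.toSubgroup) '' (V.1 : Set G)) =
      ((QuotientGroup.mk : G → G ⧸ U.toSubgroup) '' (W.1 : Set G)) → V.1 ≤ W.1 := by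
    intro V W h x hx
    have : (QuotientGroup.mk x : G ⧸ U.toSubgroup) ∈
        ((QuotientGroup.mk : G → G ⧸ U.toSubgroup) '' (W.1 : Set G)) := h ▸ ⟨x, hx, rfl⟩
    obtain ⟨y, hy, hyx⟩ := this
    have h1 : y⁻¹ * x ∈ U := QuotientGroup.eq.1 hyx
    have h2 := mul_mem (show y ∈ W.1 from hy) (W.2 h1)
    simpa using h2
  intro V W h
  exact Subtype.ext (le_antisymm (key V W h) (key W V h.symm))

instance [IsTopologicalGroup G] [CompactSpace G] (U : ConjClass G) : Finite (Below U) := by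
  have := finite_above U.rep
  have hex : ∀ V : Below U, ∃ W : {W : OpenSubgroup G // U.rep ≤ W}, cls W.1 = V.1 := by
    rintro ⟨V, g, hg⟩
    refine ⟨⟨conjOpen g⁻¹ V.rep, fun x hx => ?_⟩, ?_⟩
    · rw [mem_conjOpen]
      simpa using hg x hx
    · refine Eq.trans (cls_eq_iff.2 ⟨g, fun x => ?_⟩) (cls_rep V)
      rw [mem_conjOpen]
      simp
  choose f hf using hex
  refine Finite.of_injective f fun V W h => Subtype.ext ?_
  rw [← hf V, ← hf W, h]

noncomputable instance [IsTopologicalGroup G] [CompactSpace G] (U : ConjClass G) :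
    Fintype (Below U) := Fintype.ofFinite _

/-- `φ_U(G/V)`: the number of `U`-invariant elements of `G/V`. -/
noncomputable def phi (U V : ConjClass G) : ℕ :=
  Nat.card (MulAction.fixedPoints U.rep.toSubgroup (G ⧸ V.rep.toSubgroup))

/-- `(V:U)`, which represents `(G:U)/(G:V)`; it is used only for `[V] ⪯ [U]`. -/
noncomputable def idx (V U : ConjClass G) : ℕ :=
  U.rep.toSubgroup.index / V.rep.toSubgroup.index

open Classical in
/-- The matrix `ζ_G^q`, for an element `q` of a commutative ring. -/
noncomputable def zeta {R : Type*} [CommRing R] (q : R) (V W : ConjClass G) : R :=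
  if Prec W V then (phi V W : R) * q ^ (idx W V - 1) else 0

section Compact

variable [IsTopologicalGroup G] [CompactSpace G]

open Classical in
/-- `μ_{G,U}^q`: the inverse over `ℚ[q]` of the restriction of `ζ_G^q` to the classes `⪯ [U]`. -/
noncomputable def mu (U : ConjClass G) : Matrix (Below U) (Below U) (Polynomial ℚ) :=
  (Matrix.of fun V W : Below U => zeta (Polynomial.X : Polynomial ℚ) V.1 W.1)⁻¹

/-- The polynomial `P_{V,W}^U(q) ∈ ℚ[q]`. The entry `zeta Z V` vanishes unless `[V] ⪯ [Z]`, so the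
sum is over the classes `[Z]` with `[V], [W] ⪯ [Z] ⪯ [U]`. -/
noncomputable def structurePoly (V W U : ConjClass G) : Polynomial ℚ :=
  ∑ Z : Below U, mu U (Below.top U) Z *
    (zeta (Polynomial.X : Polynomial ℚ) Z.1 V * zeta (Polynomial.X : Polynomial ℚ) Z.1 W)

/-- The number of double cosets `V g W` with `[V ∩ g W g⁻¹] = [U]`. -/
noncomputable def mackeyCount (V W U : ConjClass G) : ℕ :=
  Nat.card {D : DoubleCoset.Quotient (V.rep : Set G) (W.rep : Set G) //
    cls (V.rep ⊓ conjOpen (Quotient.out D) W.rep) = U}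

end Compact

end OpenSubgroups

section Functor

variable (G : Type u) [Group G] [TopologicalSpace G]

/-- The set `A^{𝒪(G)}`, deliberately without any algebraic structure. -/
def NrSet (A : Type v) : Type (max u v) := ConjClass G → A

variable {G}

/-- The map `x ↦ f ∘ x`; it visibly respects identities and compositions. -/
def NrSet.map {A B : Type v} (f : A → B) (x : NrSet G A) : NrSet G B := fun U => f (x U)

variable [IsTopologicalGroup G] [CompactSpace G]

/-- The map `x ↦ ζ_G^q x` from `A^{𝒪(G)}` to the ghost ring, the latter being the product ring. -/
noncomputable def ghost (q : ℤ) {A : Type v} [CommRing A] (x : NrSet G A) : ConjClass G → A :=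
  fun U => ∑ W : Below U, zeta (q : A) U W.1 * x W.1

/-- A family of (not necessarily unital) commutative ring structures on the sets `A^{𝒪(G)}`,
for all commutative unital rings `A`, is a functor with `f ↦ (x ↦ f ∘ x)` on morphisms,
and `x ↦ ζ_G^q x` is a ring homomorphism for every `A`. -/
structure IsNecklaceFunctor (q : ℤ)
    (S : ∀ (A : Type v) [CommRing A], NonUnitalCommRing (NrSet G A)) : Prop where
  map_add : ∀ {A B : Type v} [CommRing A] [CommRing B] (f : A →+* B) (x y : NrSet G A),
    NrSet.map f (x + y) = NrSet.map f x + NrSet.map f y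
  map_mul : ∀ {A B : Type v} [CommRing A] [CommRing B] (f : A →+* B) (x y : NrSet G A),
    NrSet.map f (x * y) = NrSet.map f x * NrSet.map f y
  ghost_add : ∀ {A : Type v} [CommRing A] (x y : NrSet G A),
    ghost q (x + y) = ghost q x + ghost q y
  ghost_mul : ∀ {A : Type v} [CommRing A] (x y : NrSet G A),
    ghost q (x * y) = ghost q x * ghost q y

open Classical in
/-- The standard basis vector supported at `[V]`. -/
noncomputable def basisVec (A : Type v) [CommRing A] (V : ConjClass G) : NrSet G A :=
  fun U => if U = V then 1 else 0

end Functor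

section Burnside

variable (G : Type u) [Group G] [TopologicalSpace G]

/-- An almost finite `G`-space: a discrete space with a continuous `G`-action (that is, with open
stabilizers) on which every open subgroup has finitely many fixed points. -/
structure AlmostFinite where
  carrier : Type u
  [action : MulAction G carrier]
  isOpen_stabilizer : ∀ x : carrier, IsOpen (MulAction.stabilizer G x : Set G)
  finite_fixed : ∀ U : OpenSubgroup G, (MulAction.fixedPoints U.toSubgroup carrier).Finite

attribute [instance] AlmostFinite.action

variable {G}

theorem mem_fixed {X : Type*} [MulAction G X] {U : OpenSubgroup G} {x : X} :
    x ∈ MulAction.fixedPoints U.toSubgroup X ↔ ∀ g ∈ U, g • x = x :=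
  ⟨fun h g hg => h ⟨g, hg⟩, fun h g => h g.1 g.2⟩

namespace AlmostFinite

/-- Isomorphism of `G`-spaces. -/
instance setoid : Setoid (AlmostFinite G) where
  r X Y := ∃ e : X.carrier ≃ Y.carrier, ∀ (g : G) (x : X.carrier), e (g • x) = g • e x
  iseqv :=
    { refl := fun X => ⟨Equiv.refl _, fun _ _ => rfl⟩
      symm := by
        rintro X Y ⟨e, h⟩
        refine ⟨e.symm, fun g y => ?_⟩
        rw [Equiv.symm_apply_eq, h, Equiv.apply_symm_apply]
      trans := by
        rintro X Y Z ⟨e, h⟩ ⟨f, k⟩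
        exact ⟨e.trans f, fun g x => by simp [h, k]⟩ }

theorem stab_inl (X Y : AlmostFinite G) (x : X.carrier) :
    MulAction.stabilizer G (Sum.inl x : X.carrier ⊕ Y.carrier) = MulAction.stabilizer G x := by
  ext g
  simp [MulAction.mem_stabilizer_iff, Sum.smul_inl]

theorem stab_inr (X Y : AlmostFinite G) (y : Y.carrier) :
    MulAction.stabilizer G (Sum.inr y : X.carrier ⊕ Y.carrier) = MulAction.stabilizer G y := by
  ext g
  simp [MulAction.mem_stabilizer_iff, Sum.smul_inr]

theorem inl_mem_fixed (X Y : AlmostFinite G) (U : OpenSubgroup G) (x : X.carrier) :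
    (Sum.inl x : X.carrier ⊕ Y.carrier) ∈ MulAction.fixedPoints U.toSubgroup _ ↔
      x ∈ MulAction.fixedPoints U.toSubgroup X.carrier := by
  simp [Sum.smul_inl]

theorem inr_mem_fixed (X Y : AlmostFinite G) (U : OpenSubgroup G) (y : Y.carrier) :
    (Sum.inr y : X.carrier ⊕ Y.carrier) ∈ MulAction.fixedPoints U.toSubgroup _ ↔
      y ∈ MulAction.fixedPoints U.toSubgroup Y.carrier := by
  simp [Sum.smul_inr]

/-- The disjoint union of two almost finite `G`-spaces. -/
def sum (X Y : AlmostFinite G) : AlmostFinite G where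
  carrier := X.carrier ⊕ Y.carrier
  isOpen_stabilizer := by
    rintro (x | y)
    · rw [stab_inl]; exact X.isOpen_stabilizer x
    · rw [stab_inr]; exact Y.isOpen_stabilizer y
  finite_fixed U := by
    refine (((X.finite_fixed U).image Sum.inl).union ((Y.finite_fixed U).image Sum.inr)).subset ?_
    rintro (x | y) h
    · exact Or.inl ⟨x, (inl_mem_fixed X Y U x).1 h, rfl⟩
    · exact Or.inr ⟨y, (inr_mem_fixed X Y U y).1 h, rfl⟩

/-- The product of two almost finite `G`-spaces, with the diagonal action. -/
def prod (X Y : AlmostFinite G) : AlmostFinite G where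
  carrier := X.carrier × Y.carrier
  isOpen_stabilizer := by
    rintro ⟨x, y⟩
    have : (MulAction.stabilizer G (x, y) : Set G) =
        (MulAction.stabilizer G x : Set G) ∩ (MulAction.stabilizer G y : Set G) := by
      ext g
      simp [MulAction.mem_stabilizer_iff, Prod.ext_iff]
    rw [this]
    exact (X.isOpen_stabilizer x).inter (Y.isOpen_stabilizer y)
  finite_fixed U := by
    refine ((X.finite_fixed U).prod (Y.finite_fixed U)).subset ?_
    rintro ⟨x, y⟩ h
    rw [mem_fixed] at h
    exact ⟨mem_fixed.2 fun g hg => (Prod.ext_iff.1 (h g hg)).1,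
      mem_fixed.2 fun g hg => (Prod.ext_iff.1 (h g hg)).2⟩

/-- The empty `G`-space. -/
def empty : AlmostFinite G where
  carrier := PEmpty
  action := { smul := fun _ x => x, one_smul := fun _ => rfl, mul_smul := fun _ _ _ => rfl }
  isOpen_stabilizer x := x.elim
  finite_fixed _ := Set.toFinite _

/-- The `G`-space `G/V` of left cosets of an open subgroup. -/
def coset [IsTopologicalGroup G] [CompactSpace G] (V : OpenSubgroup G) : AlmostFinite G where
  carrier := G ⧸ V.toSubgroup
  isOpen_stabilizer := by
    intro x
    induction x using QuotientGroup.induction_on with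
    | H g =>
      have : (MulAction.stabilizer G (g : G ⧸ V.toSubgroup) : Set G) =
          (conjOpen g V : Set G) := by
        ext x
        simp only [SetLike.mem_coe, MulAction.mem_stabilizer_iff, mem_conjOpen]
        rw [eq_comm, MulAction.Quotient.smul_coe, QuotientGroup.eq, smul_eq_mul, ← mul_assoc]
        rfl
      rw [this]
      exact (conjOpen g V).isOpen
  finite_fixed U := by
    have : Finite (G ⧸ V.toSubgroup) := V.toSubgroup.quotient_finite_of_isOpen V.isOpen
    exact Set.toFinite _

/-- The twisted mark `φ_U^q(X) = ∑_{x ∈ X^U} q^{(G_x : U) - 1}`. On `X = G/W` it takes the value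
`φ_U(G/W) q^{(W:U)-1}`, and for `q = 1` it is the number of `U`-invariant elements of `X`. -/
noncomputable def mark (q : ℤ) (U : OpenSubgroup G) (X : AlmostFinite G) : ℤ :=
  ∑ x ∈ (X.finite_fixed U).toFinset, q ^ (U.toSubgroup.relIndex (MulAction.stabilizer G x) - 1)

theorem mark_congr (q : ℤ) (U : OpenSubgroup G) (X Y : AlmostFinite G) (h : X ≈ Y) :
    mark q U X = mark q U Y := by
  obtain ⟨e, he⟩ := h
  have hst : ∀ x, MulAction.stabilizer G (e x) = MulAction.stabilizer G x := by
    intro x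
    ext g
    rw [MulAction.mem_stabilizer_iff, MulAction.mem_stabilizer_iff, ← he, e.injective.eq_iff]
  refine Finset.sum_equiv e (fun x => ?_) (fun x _ => by rw [hst])
  simp only [Set.Finite.mem_toFinset, mem_fixed]
  refine forall₂_congr fun g _ => ?_
  rw [← he, e.injective.eq_iff]

theorem mark_sum (q : ℤ) (U : OpenSubgroup G) (X Y : AlmostFinite G) :
    mark q U (X.sum Y) = mark q U X + mark q U Y := by
  have h : ((X.sum Y).finite_fixed U).toFinset =
      (X.finite_fixed U).toFinset.disjSum (Y.finite_fixed U).toFinset := by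
    ext z
    rcases z with (x | y)
    · refine ((Set.Finite.mem_toFinset _).trans (inl_mem_fixed X Y U x)).trans ?_
      exact ((Set.Finite.mem_toFinset _).symm).trans Finset.inl_mem_disjSum.symm
    · refine ((Set.Finite.mem_toFinset _).trans (inr_mem_fixed X Y U y)).trans ?_
      exact ((Set.Finite.mem_toFinset _).symm).trans Finset.inr_mem_disjSum.symm
  unfold mark
  rw [h]
  refine (Finset.sum_disjSum _ _ _).trans ?_
  congr 1
  · exact Finset.sum_congr rfl fun x _ =>
      congrArg (fun H : Subgroup G => q ^ (U.toSubgroup.relIndex H - 1)) (stab_inl X Y x)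
  · exact Finset.sum_congr rfl fun y _ =>
      congrArg (fun H : Subgroup G => q ^ (U.toSubgroup.relIndex H - 1)) (stab_inr X Y y)

/-- The left `U`-invariant maps `c : G_x → ℤ/n`. -/
def Colouring (n : ℕ) (U : OpenSubgroup G) (X : AlmostFinite G) (x : X.carrier) : Type u :=
  {c : MulAction.stabilizer G x → ZMod n //
    ∀ s t : MulAction.stabilizer G x, (∃ g ∈ U, (t : G) = g * s) → c t = c s}

/-- The relation `∼` on colourings induced by the translation action of `ℤ/n`. -/
def colouringSetoid (n : ℕ) (U : OpenSubgroup G) (X : AlmostFinite G) (x : X.carrier) :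
    Setoid (Colouring n U X x) where
  r c d := ∃ a : ZMod n, ∀ s, d.1 s = a + c.1 s
  iseqv :=
    { refl := fun c => ⟨0, fun s => by simp⟩
      symm := by
        rintro c d ⟨a, h⟩
        exact ⟨-a, fun s => by simp [h]⟩
      trans := by
        rintro c d e ⟨a, h⟩ ⟨b, k⟩
        exact ⟨b + a, fun s => by rw [k, h, add_assoc]⟩ }

/-- The number of `∼`-classes of `U`-invariant `ℤ/n`-coloured elements of `X`: pairs of a
`U`-invariant `x ∈ X` and a left `U`-invariant map `G_x → ℤ/n`, modulo translation by `ℤ/n`. -/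
noncomputable def colouredCount (n : ℕ) (U : OpenSubgroup G) (X : AlmostFinite G) : ℕ :=
  Nat.card (Σ x : MulAction.fixedPoints U.toSubgroup X.carrier,
    Quotient (colouringSetoid n U X x.1))

end AlmostFinite

variable (G) in
/-- Isomorphism classes of almost finite `G`-spaces. -/
def IsoClass : Type (u + 1) := Quotient (AlmostFinite.setoid (G := G))

namespace IsoClass

/-- Addition of isomorphism classes is disjoint union. -/
instance : Add (IsoClass G) where
  add := Quotient.map₂ AlmostFinite.sum (by
    rintro X X' ⟨e, he⟩ Y Y' ⟨f, hf⟩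
    refine ⟨Equiv.sumCongr e f, ?_⟩
    rintro g (x | y)
    · exact congrArg Sum.inl (he g x)
    · exact congrArg Sum.inr (hf g y))

instance : Zero (IsoClass G) where
  zero := Quotient.mk _ AlmostFinite.empty

instance : AddCommMonoid (IsoClass G) where
  nsmul := nsmulRec
  add_assoc := by
    rintro ⟨X⟩ ⟨Y⟩ ⟨Z⟩
    refine Quotient.sound ⟨Equiv.sumAssoc _ _ _, ?_⟩
    rintro g ((x | y) | z) <;> rfl
  add_comm := by
    rintro ⟨X⟩ ⟨Y⟩
    refine Quotient.sound ⟨Equiv.sumComm _ _, ?_⟩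
    rintro g (x | y) <;> rfl
  zero_add := by
    rintro ⟨X⟩
    refine Quotient.sound ⟨Equiv.emptySum PEmpty X.carrier, ?_⟩
    rintro g (x | y)
    · exact x.elim
    · rfl
  add_zero := by
    rintro ⟨X⟩
    refine Quotient.sound ⟨Equiv.sumEmpty X.carrier PEmpty, ?_⟩
    rintro g (x | y)
    · rfl
    · exact y.elim

/-- The twisted mark on isomorphism classes. -/
noncomputable def mark (q : ℤ) (U : OpenSubgroup G) : IsoClass G →+ ℤ where
  toFun := Quotient.lift (AlmostFinite.mark q U) (AlmostFinite.mark_congr q U)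
  map_zero' := by
    change AlmostFinite.mark q U AlmostFinite.empty = 0
    exact Finset.sum_eq_zero fun x _ => x.elim
  map_add' := by
    rintro ⟨X⟩ ⟨Y⟩
    exact AlmostFinite.mark_sum q U X Y

end IsoClass

variable (G) in
/-- The set `Ω̂(G)`: the Grothendieck group of isomorphism classes of almost finite `G`-spaces
under disjoint union. No multiplication is put on it here. -/
abbrev BurnsideGroup : Type (u + 1) := Algebra.GrothendieckAddGroup (IsoClass G)

/-- The class `[X] ∈ Ω̂(G)` of an almost finite `G`-space. -/
noncomputable def burnsideClass (X : AlmostFinite G) : BurnsideGroup G :=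
  Algebra.GrothendieckAddGroup.of (Quotient.mk _ X : IsoClass G)

/-- The ordinary addition of `Ω̂(G)`, with `[X] + [Y]` the class of the disjoint union. -/
noncomputable def burnsideAdd (a b : BurnsideGroup G) : BurnsideGroup G := a + b

/-- The additive extension to `Ω̂(G)` of the twisted mark `φ_U^q`. -/
noncomputable def twistedMark (q : ℤ) (U : OpenSubgroup G) : BurnsideGroup G →+ ℤ :=
  Algebra.GrothendieckAddGroup.lift (IsoClass.mark q U)

/-- A commutative ring structure `(⊕, ⊗)` on the set `Ω̂(G)` is the twisted Burnside ring
`Ω̂^q(G)`: all twisted marks `φ_U^q` are ring homomorphisms to `ℤ`. -/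
def IsTwistedBurnsideRing (q : ℤ) (T : NonUnitalCommRing (BurnsideGroup G)) : Prop :=
  ∀ (U : OpenSubgroup G) (a b : BurnsideGroup G),
    twistedMark q U (T.add a b) = twistedMark q U a + twistedMark q U b ∧
    twistedMark q U (T.mul a b) = twistedMark q U a * twistedMark q U b

end Burnside

end QNecklace

/-! Only finitely many classes lie below a given one, and `ζ_G^q` is triangular for this order with
diagonal entries φ_U(G/U) = (N(U):U), positive integers that do not involve q. Hence `zmul q` is
injective over rings without ℤ-torsion and bijective over ℚ-algebras (`zmul_injective`,
`zmul_surjective`). Over a torsion-free ring the ghost map therefore determines the ring structure,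
and every A is a quotient of the torsion-free ring ℤ[A], so functoriality determines it for all A.
The ring axioms descend along the same quotient.

The substance of existence is integrality: the product of two columns of `ζ_G^q` must be an integral
combination of columns. The coefficients over ℚ are the values at q of the polynomials P. For a
natural number q = n they are tested one prime p at a time. If p divides n, every entry of row U
stays p-integral after division by φ_U(G/U). This follows from the divisibility of φ_U(G/Y)·(Y:U) by
φ_U(G/U), an orbit count for the normalizer (`phi_self_dvd`), since n^{(Y:U)-1} contains the p-part
of (Y:U). If p does not divide n, then n times a column of `ζ_G^n` counts the fixed points of an
actual G-space, the ℤ/n-colourings of cosets (`mark_colourSpace`). Products of such spaces turn the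
problem into an integral triangular system whose diagonal n² is invertible at p. Negative q follow
because a rational polynomial that is integral on ℕ is integral on ℤ (`exists_int_eval`).

For the Burnside side, every almost finite G-space is a disjoint union of cosets with finite
multiplicities m, and its q-marks are ζ_G^q m (`exists_equiv_ofMult`, `mark_ofMult`). So marks
separate elements of Ω̂(G), and Ω̂(G) is in bijection with ℤ^{𝒪(G)}, through which the product is
transported. For q = 1 marks count fixed points, which are multiplicative on products of spaces;
decomposing G/V × G/W into orbits gives the double coset formula. -/

namespace QNecklace

/-! ### The order on conjugacy classes of open subgroups. -/

section Order

variable {G : Type u} [Group G] [TopologicalSpace G]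

theorem OpenSubgroup.finiteIndex [IsTopologicalGroup G] [CompactSpace G] (U : OpenSubgroup G) :
    U.toSubgroup.FiniteIndex := by
  have : Finite (G ⧸ U.toSubgroup) := U.toSubgroup.quotient_finite_of_isOpen U.isOpen
  exact Subgroup.finiteIndex_of_finite_quotient

theorem OpenSubgroup.index_ne_zero [IsTopologicalGroup G] [CompactSpace G] (U : OpenSubgroup G) :
    U.toSubgroup.index ≠ 0 :=
  (OpenSubgroup.finiteIndex U).index_ne_zero

theorem OpenSubgroup.relIndex_ne_zero [IsTopologicalGroup G] [CompactSpace G] (U : OpenSubgroup G)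
    (H : Subgroup G) : U.toSubgroup.relIndex H ≠ 0 := by
  have := OpenSubgroup.finiteIndex U
  exact Subgroup.FiniteIndex.index_ne_zero

variable [IsTopologicalGroup G]

theorem conjOpen_one (U : OpenSubgroup G) : conjOpen 1 U = U := by
  ext x; simp [mem_conjOpen]

theorem conjOpen_conjOpen (g h : G) (U : OpenSubgroup G) :
    conjOpen g (conjOpen h U) = conjOpen (g * h) U := by
  ext x; simp [mem_conjOpen, mul_assoc]

theorem conjOpen_mono (g : G) {U V : OpenSubgroup G} (h : U ≤ V) : conjOpen g U ≤ conjOpen g V :=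
  fun _ hx => mem_conjOpen.2 (h (mem_conjOpen.1 hx))

theorem index_conjOpen (g : G) (U : OpenSubgroup G) :
    (conjOpen g U).toSubgroup.index = U.toSubgroup.index :=
  Subgroup.index_comap_of_surjective U.toSubgroup (f := (MulAut.conj g⁻¹).toMonoidHom)
    (MulAut.conj g⁻¹).surjective

theorem cls_eq_iff_conjOpen {U V : OpenSubgroup G} : cls U = cls V ↔ ∃ g, U = conjOpen g V := by
  rw [cls_eq_iff]
  constructor
  · rintro ⟨g, h⟩
    refine ⟨g⁻¹, ?_⟩
    ext x
    rw [mem_conjOpen, h, inv_inv]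
  · rintro ⟨g, rfl⟩
    exact ⟨g⁻¹, fun x => by rw [mem_conjOpen, inv_inv]⟩

theorem cls_conjOpen (g : G) (U : OpenSubgroup G) : cls (conjOpen g U) = cls U :=
  cls_eq_iff_conjOpen.2 ⟨g, rfl⟩

theorem exists_conjOpen_rep (U : OpenSubgroup G) : ∃ g, U = conjOpen g (cls U).rep :=
  cls_eq_iff_conjOpen.1 (cls_rep (cls U)).symm

theorem prec_iff {V U : ConjClass G} : Prec V U ↔ ∃ g, U.rep ≤ conjOpen g V.rep := by
  constructor
  · rintro ⟨g, h⟩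
    exact ⟨g⁻¹, fun x hx => mem_conjOpen.2 (by simpa using h x hx)⟩
  · rintro ⟨g, h⟩
    exact ⟨g⁻¹, fun _ hx => by simpa using mem_conjOpen.1 (h hx)⟩

theorem prec_cls_iff {V U : OpenSubgroup G} : Prec (cls V) (cls U) ↔ ∃ g, U ≤ conjOpen g V := by
  rw [prec_iff]
  obtain ⟨a, ha⟩ := exists_conjOpen_rep U
  obtain ⟨b, hb⟩ := exists_conjOpen_rep V
  generalize (cls U).rep = U' at *
  generalize (cls V).rep = V' at *
  subst ha hb
  constructor
  · rintro ⟨g, h⟩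
    exact ⟨a * g * b⁻¹, by
      simpa only [conjOpen_conjOpen, inv_mul_cancel_right] using conjOpen_mono a h⟩
  · rintro ⟨g, h⟩
    refine ⟨a⁻¹ * g * b, ?_⟩
    simpa only [conjOpen_conjOpen, inv_mul_cancel, conjOpen_one, mul_assoc] using
      conjOpen_mono a⁻¹ h

theorem Prec.trans {U V W : ConjClass G} (h : Prec U V) (k : Prec V W) : Prec U W := by
  rw [prec_iff] at *
  obtain ⟨a, ha⟩ := h
  obtain ⟨b, hb⟩ := k
  exact ⟨b * a, hb.trans (by rw [← conjOpen_conjOpen]; exact conjOpen_mono b ha)⟩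

variable [CompactSpace G]

theorem OpenSubgroup.eq_of_le_of_index_le {U V : OpenSubgroup G} (h : U ≤ V)
    (hi : U.toSubgroup.index ≤ V.toSubgroup.index) : U = V := by
  by_contra hne
  have := OpenSubgroup.finiteIndex U
  have hlt : U.toSubgroup < V.toSubgroup :=
    lt_of_le_of_ne h fun e => hne (OpenSubgroup.toSubgroup_injective e)
  exact absurd (Subgroup.index_strictAnti hlt) (not_lt.2 hi)

/-- Conjugation preserves the index, so equal index would turn the inclusion into equality. The
index is thus a rank function for the order, which gives antisymmetry and the inductions below. -/
theorem Prec.index_lt {V U : ConjClass G} (h : Prec V U) (hne : V ≠ U) :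
    V.rep.toSubgroup.index < U.rep.toSubgroup.index := by
  obtain ⟨g, hg⟩ := prec_iff.1 h
  by_contra hlt
  refine hne ?_
  have := OpenSubgroup.eq_of_le_of_index_le hg (by rw [index_conjOpen]; exact not_lt.1 hlt)
  rw [← cls_rep U, this, cls_conjOpen, cls_rep]

theorem Prec.antisymm {V U : ConjClass G} (h : Prec V U) (k : Prec U V) : V = U := by
  by_contra hne
  exact absurd (h.index_lt hne) (not_lt.2 (k.index_lt (Ne.symm hne)).le)

/-- Induction along the strict order of classes. -/
theorem ConjClass.induction {p : ConjClass G → Prop}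
    (h : ∀ U, (∀ V, Prec V U → V ≠ U → p V) → p U) (U : ConjClass G) : p U := by
  induction hn : U.rep.toSubgroup.index using Nat.strong_induction_on generalizing U with
  | _ n ih => exact h U fun V hV hne => ih _ (hn ▸ hV.index_lt hne) V rfl

theorem finite_fixedPoints_quotient (U V : OpenSubgroup G) :
    Finite (MulAction.fixedPoints U.toSubgroup (G ⧸ V.toSubgroup)) := by
  have : Finite (G ⧸ V.toSubgroup) := V.toSubgroup.quotient_finite_of_isOpen V.isOpen
  infer_instance

theorem phi_self_pos (U : ConjClass G) : 0 < phi U U := by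
  have := finite_fixedPoints_quotient U.rep U.rep
  have : Nonempty (MulAction.fixedPoints U.rep.toSubgroup (G ⧸ U.rep.toSubgroup)) := by
    refine ⟨⟨((1 : G) : G ⧸ U.rep.toSubgroup), fun g => ?_⟩⟩
    change ((g.1 * 1 : G) : G ⧸ U.rep.toSubgroup) = _
    rw [eq_comm, QuotientGroup.eq]
    simp
  exact Nat.card_pos

end Order

/-! ### Triangularity of the matrix `ζ_G^q` and its consequences. -/

section Triangular

variable {G : Type u} [Group G] [TopologicalSpace G]

theorem zeta_self {R : Type*} [CommRing R] (q : R) (U : ConjClass G) :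
    zeta q U U = (phi U U : R) := by
  have : idx U U - 1 = 0 := by
    unfold idx
    rcases Nat.eq_zero_or_pos U.rep.toSubgroup.index with h | h
    · simp [h]
    · rw [Nat.div_self h]
  simp [zeta, Prec.refl U, this]

theorem zeta_eq_zero {R : Type*} [CommRing R] (q : R) {U V : ConjClass G} (h : ¬ Prec V U) :
    zeta q U V = 0 := if_neg h

theorem map_zeta {R S : Type*} [CommRing R] [CommRing S] (f : R →+* S) (q : R)
    (U V : ConjClass G) : f (zeta q U V) = zeta (f q) U V := by
  unfold zeta
  split_ifs <;> simp

variable [IsTopologicalGroup G] [CompactSpace G]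

/-- Multiplication by the matrix `ζ_G^q` over any commutative ring. -/
noncomputable def zmul {R : Type*} [CommRing R] (q : R) (x : ConjClass G → R) (U : ConjClass G) :
    R := ∑ W : Below U, zeta q U W.1 * x W.1

open Classical in
theorem sum_below_eq {R : Type*} [AddCommMonoid R] (U : ConjClass G) (f : ConjClass G → R) :
    ∑ W : Below U, f W.1 = f U + ∑ W : Below U, if W.1 = U then 0 else f W.1 := by
  rw [← Finset.add_sum_erase _ _ (Finset.mem_univ (Below.top U)),
    ← Finset.add_sum_erase (Finset.univ : Finset (Below U)) (fun W => if W.1 = U then 0 else f W.1)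
      (Finset.mem_univ (Below.top U)), if_pos (show (Below.top U).1 = U from rfl), zero_add]
  refine congrArg _ (Finset.sum_congr rfl fun W hW => ?_)
  exact (if_neg fun h : W.1 = U => (Finset.mem_erase.1 hW).1 (Subtype.ext h)).symm

/-- Allows all sums in a matrix computation to run over one common index set `Below U`. -/
theorem sum_below_mono {R : Type*} [AddCommMonoid R] {Z U : ConjClass G} (h : Prec Z U)
    (f : ConjClass G → R) (hf : ∀ W, ¬ Prec W Z → f W = 0) :
    ∑ W : Below Z, f W.1 = ∑ W : Below U, f W.1 := by
  refine Finset.sum_of_injOn (fun W : Below Z => (⟨W.1, W.2.trans h⟩ : Below U)) ?_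
    (fun _ _ => Finset.mem_coe.2 (Finset.mem_univ _)) ?_ fun _ _ => rfl
  · intro V _ W _ hVW
    exact Subtype.ext (congrArg (fun Y : Below U => Y.1) hVW)
  · intro W _ hW
    exact hf W.1 fun hWZ => hW ⟨⟨W.1, hWZ⟩, Finset.mem_coe.2 (Finset.mem_univ _), rfl⟩

open Classical in
theorem zmul_eq {R : Type*} [CommRing R] (q : R) (x : ConjClass G → R) (U : ConjClass G) :
    zmul q x U = phi U U * x U +
      ∑ W : Below U, if W.1 = U then 0 else zeta q U W.1 * x W.1 := by
  rw [zmul, sum_below_eq U fun W => zeta q U W * x W, zeta_self]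

/-- Once the lower coordinates vanish, row U reads φ_U(G/U)·x_U = 0. Since only rows below U are
assumed to vanish, this also controls supports of solutions. -/
theorem zmul_eq_zero_below {R : Type*} [CommRing R]
    (hR : ∀ n : ℕ, n ≠ 0 → ∀ a : R, (n : R) * a = 0 → a = 0) (q : R) {x : ConjClass G → R}
    (U : ConjClass G) (h : ∀ V, Prec V U → zmul q x V = 0) : x U = 0 := by
  induction U using ConjClass.induction with
  | h U ih =>
    have h0 := h U (Prec.refl U)
    rw [zmul_eq, Finset.sum_eq_zero, add_zero] at h0
    · exact hR _ (phi_self_pos U).ne' _ h0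
    · intro W _
      split_ifs with hW
      · rfl
      · rw [ih W.1 W.2 hW fun V hV => h V (hV.trans W.2), mul_zero]

theorem zmul_sub {R : Type*} [CommRing R] (q : R) (x y : ConjClass G → R) :
    zmul q (x - y) = zmul q x - zmul q y := by
  funext U
  simp [zmul, mul_sub]

theorem zmul_add {R : Type*} [CommRing R] (q : R) (x y : ConjClass G → R) :
    zmul q (x + y) = zmul q x + zmul q y := by
  funext U
  simp [zmul, mul_add, Finset.sum_add_distrib]

theorem zmul_injective {R : Type*} [CommRing R]
    (hR : ∀ n : ℕ, n ≠ 0 → ∀ a : R, (n : R) * a = 0 → a = 0) (q : R) :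
    Function.Injective (zmul q : (ConjClass G → R) → ConjClass G → R) := by
  intro x y h
  funext U
  refine sub_eq_zero.1 (zmul_eq_zero_below hR q (x := x - y) U fun V _ => ?_)
  rw [zmul_sub, h, sub_self, Pi.zero_apply]

theorem zmul_surjective {R : Type*} [CommRing R] (hR : ∀ n : ℕ, n ≠ 0 → IsUnit (n : R)) (q : R) :
    Function.Surjective (zmul q : (ConjClass G → R) → ConjClass G → R) := by
  classical
  intro a
  have hwf : WellFounded fun V U : ConjClass G =>
      V.rep.toSubgroup.index < U.rep.toSubgroup.index :=
    (measure fun U : ConjClass G => U.rep.toSubgroup.index).wf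
  -- Forward substitution: row U is solved for its diagonal unknown, the strictly lower ones being
  -- known by recursion on the index.
  let F : ∀ U : ConjClass G,
      (∀ V : ConjClass G, V.rep.toSubgroup.index < U.rep.toSubgroup.index → R) → R := fun U x =>
    Ring.inverse (phi U U : R) *
      (a U - ∑ W : Below U, if h : W.1 = U then 0 else zeta q U W.1 * x W.1 (W.2.index_lt h))
  refine ⟨hwf.fix F, funext fun U => ?_⟩
  rw [zmul_eq, hwf.fix_eq F U]
  change _ * (Ring.inverse _ * _) + _ = _
  rw [← mul_assoc, Ring.mul_inverse_cancel _ (hR _ (phi_self_pos U).ne'), one_mul, sub_add_eq_add_sub,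
    sub_eq_iff_eq_add]
  refine congrArg _ (Finset.sum_congr rfl fun W _ => ?_)
  split_ifs <;> rfl

theorem map_zmul {R S : Type*} [CommRing R] [CommRing S] (f : R →+* S) (q : R)
    (x : ConjClass G → R) (U : ConjClass G) :
    f (zmul q x U) = zmul (f q) (fun W => f (x W)) U := by
  simp [zmul, map_zeta]

end Triangular
-- Twisted marks and the orbit decomposition of almost finite G-spaces.
namespace AlmostFinite

variable {G : Type u} [Group G] [TopologicalSpace G]

/-- The stabilizer of a point, as an open subgroup. -/
def stab (X : AlmostFinite G) (x : X.carrier) : OpenSubgroup G :=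
  ⟨MulAction.stabilizer G x, X.isOpen_stabilizer x⟩

theorem mem_stab {X : AlmostFinite G} {x : X.carrier} {g : G} : g ∈ X.stab x ↔ g • x = x :=
  MulAction.mem_stabilizer_iff

theorem mem_fixed_iff_le {X : AlmostFinite G} {x : X.carrier} {U : OpenSubgroup G} :
    x ∈ MulAction.fixedPoints U.toSubgroup X.carrier ↔ U ≤ X.stab x :=
  mem_fixed.trans (forall₂_congr fun _ _ => mem_stab.symm)

theorem mark_one_left (U : OpenSubgroup G) (X : AlmostFinite G) :
    mark 1 U X = Nat.card (MulAction.fixedPoints U.toSubgroup X.carrier) := by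
  have := (X.finite_fixed U).to_subtype
  rw [mark, Finset.sum_congr rfl fun _ _ => one_pow _, Finset.sum_const, nsmul_one,
    Nat.card_eq_card_finite_toFinset (X.finite_fixed U)]

theorem mark_one_prod (U : OpenSubgroup G) (X Y : AlmostFinite G) :
    mark 1 U (X.prod Y) = mark 1 U X * mark 1 U Y := by
  rw [mark_one_left, mark_one_left, mark_one_left, ← Nat.cast_mul, ← Nat.card_prod]
  congr 1
  refine (Nat.card_congr (Equiv.subtypeEquivRight fun p => ?_)).trans
    (Nat.card_congr (Equiv.subtypeProdEquivProd
      (p := fun x => x ∈ MulAction.fixedPoints U.toSubgroup X.carrier)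
      (q := fun y => y ∈ MulAction.fixedPoints U.toSubgroup Y.carrier)))
  rw [mem_fixed, mem_fixed, mem_fixed, ← forall₂_and]
  exact forall₂_congr fun g _ => Prod.ext_iff

variable [IsTopologicalGroup G]

theorem stab_smul (X : AlmostFinite G) (g : G) (x : X.carrier) :
    X.stab (g • x) = conjOpen g (X.stab x) := by
  ext h
  rw [mem_conjOpen, mem_stab, mem_stab, mul_smul, mul_smul, inv_smul_eq_iff]

theorem smul_mem_fixed {X : AlmostFinite G} {x : X.carrier} {U : OpenSubgroup G} (g : G) :
    g • x ∈ MulAction.fixedPoints (conjOpen g U).toSubgroup X.carrier ↔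
      x ∈ MulAction.fixedPoints U.toSubgroup X.carrier := by
  rw [mem_fixed_iff_le, mem_fixed_iff_le, stab_smul]
  refine ⟨fun h => ?_, conjOpen_mono g⟩
  simpa only [conjOpen_conjOpen, inv_mul_cancel, conjOpen_one] using conjOpen_mono g⁻¹ h

variable [CompactSpace G]

theorem relIndex_stab {X : AlmostFinite G} {x : X.carrier} {U : OpenSubgroup G}
    (h : x ∈ MulAction.fixedPoints U.toSubgroup X.carrier) :
    U.toSubgroup.relIndex (MulAction.stabilizer G x) =
      U.toSubgroup.index / (X.stab x).toSubgroup.index := by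
  have hle : U.toSubgroup ≤ (X.stab x).toSubgroup := mem_fixed_iff_le.1 h
  rw [← Subgroup.relIndex_mul_index hle, Nat.mul_div_cancel _
    (Nat.pos_of_ne_zero (OpenSubgroup.index_ne_zero _))]
  rfl

theorem mark_eq (q : ℤ) (U : OpenSubgroup G) (X : AlmostFinite G) :
    mark q U X = ∑ x ∈ (X.finite_fixed U).toFinset,
      q ^ (U.toSubgroup.index / (X.stab x).toSubgroup.index - 1) :=
  Finset.sum_congr rfl fun _ hx => by rw [relIndex_stab ((Set.Finite.mem_toFinset _).1 hx)]

theorem mark_conjOpen (q : ℤ) (g : G) (U : OpenSubgroup G) (X : AlmostFinite G) :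
    mark q (conjOpen g U) X = mark q U X := by
  rw [mark_eq, mark_eq]
  refine (Finset.sum_equiv (MulAction.toPerm g) (fun x => ?_) fun x _ => ?_).symm
  · rw [Set.Finite.mem_toFinset, Set.Finite.mem_toFinset]
    exact (smul_mem_fixed g).symm
  · rw [MulAction.toPerm_apply, stab_smul, index_conjOpen, index_conjOpen]

theorem mark_rep_cls (q : ℤ) (U : OpenSubgroup G) (X : AlmostFinite G) :
    mark q (cls U).rep X = mark q U X := by
  obtain ⟨g, h⟩ := exists_conjOpen_rep U
  conv_rhs => rw [h]
  rw [mark_conjOpen]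

/-- The coset `gV`, as a point of the `G`-space `G/V`. -/
def cosetMk (V : OpenSubgroup G) (g : G) : (coset V).carrier := (g : G ⧸ V.toSubgroup)

theorem cosetMk_surjective (V : OpenSubgroup G) : Function.Surjective (cosetMk V) :=
  QuotientGroup.mk_surjective

theorem cosetMk_eq_iff {V : OpenSubgroup G} {g h : G} :
    cosetMk V g = cosetMk V h ↔ g⁻¹ * h ∈ V := QuotientGroup.eq

theorem smul_cosetMk (V : OpenSubgroup G) (g h : G) :
    g • cosetMk V h = cosetMk V (g * h) := rfl

theorem stab_cosetMk (V : OpenSubgroup G) (g : G) :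
    (coset V).stab (cosetMk V g) = conjOpen g V := by
  ext h
  rw [mem_conjOpen, mem_stab, eq_comm, smul_cosetMk, cosetMk_eq_iff, mul_assoc]

theorem exists_stab_coset (V : OpenSubgroup G) (x : (coset V).carrier) :
    ∃ g : G, (coset V).stab x = conjOpen g V := by
  obtain ⟨g, rfl⟩ := cosetMk_surjective V x
  exact ⟨g, stab_cosetMk V g⟩

theorem card_fixed_coset_rep (U V : ConjClass G) :
    phi U V = ((coset V.rep).finite_fixed U.rep).toFinset.card := by
  have := ((coset V.rep).finite_fixed U.rep).to_subtype
  exact Nat.card_eq_card_finite_toFinset ((coset V.rep).finite_fixed U.rep)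

theorem prec_of_mem_fixed_coset {U V : OpenSubgroup G} {x : (coset V).carrier}
    (h : x ∈ MulAction.fixedPoints U.toSubgroup (coset V).carrier) : Prec (cls V) (cls U) := by
  obtain ⟨g, hg⟩ := exists_stab_coset V x
  exact prec_cls_iff.2 ⟨g, hg ▸ mem_fixed_iff_le.1 h⟩

/-- All points of G/V have stabilizers conjugate to V, so the exponent is constant over the fixed
points. -/
theorem mark_coset_rep (q : ℤ) (U V : ConjClass G) :
    mark q U.rep (coset V.rep) = zeta q U V := by
  by_cases h : Prec V U
  · rw [mark_eq, zeta, if_pos h, card_fixed_coset_rep, idx, ← nsmul_eq_mul]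
    refine Finset.sum_eq_card_nsmul fun x _ => ?_
    obtain ⟨g, hg⟩ := exists_stab_coset V.rep x
    rw [hg, index_conjOpen]
  · rw [zeta, if_neg h]
    refine Finset.sum_eq_zero fun x hx => absurd ?_ h
    rw [← cls_rep V, ← cls_rep U]
    exact prec_of_mem_fixed_coset ((Set.Finite.mem_toFinset _).1 hx)

/-- The `G`-space containing `m W` copies of `G/W` for every class `W`. -/
noncomputable def ofMult (m : ConjClass G → ℕ) : AlmostFinite G where
  carrier := Σ W : ConjClass G, Fin (m W) × (coset W.rep).carrier
  action :=
    { smul := fun g x => ⟨x.1, x.2.1, g • x.2.2⟩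
      one_smul := fun x => congrArg (fun c => (⟨x.1, x.2.1, c⟩ : Σ W : ConjClass G,
        Fin (m W) × (coset W.rep).carrier)) (one_smul G x.2.2)
      mul_smul := fun g h x => congrArg (fun c => (⟨x.1, x.2.1, c⟩ : Σ W : ConjClass G,
        Fin (m W) × (coset W.rep).carrier)) (mul_smul g h x.2.2) }
  isOpen_stabilizer := by
    rintro ⟨W, i, x⟩
    convert! (coset W.rep).isOpen_stabilizer x using 1
    ext g
    simp only [SetLike.mem_coe, MulAction.mem_stabilizer_iff]
    change (⟨W, i, g • x⟩ : Σ W : ConjClass G, Fin (m W) × (coset W.rep).carrier) = ⟨W, i, x⟩ ↔ _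
    simp
  finite_fixed U := by
    have (W : Below (cls U)) : Finite (Fin (m W.1) × (coset W.1.rep).carrier) := by
      have : Finite (coset W.1.rep).carrier :=
        W.1.rep.toSubgroup.quotient_finite_of_isOpen W.1.rep.isOpen
      infer_instance
    refine (Set.finite_range fun y : Σ W : Below (cls U), Fin (m W.1) × (coset W.1.rep).carrier =>
      (⟨y.1.1, y.2⟩ : Σ W : ConjClass G, Fin (m W) × (coset W.rep).carrier)).subset ?_
    rintro ⟨W, i, x⟩ h
    have hx : x ∈ MulAction.fixedPoints U.toSubgroup (coset W.rep).carrier := fun g => by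
      have := h g
      change (⟨W, i, g • x⟩ : Σ W : ConjClass G, Fin (m W) × (coset W.rep).carrier) = ⟨W, i, x⟩
        at this
      simpa using this
    have := prec_of_mem_fixed_coset hx
    rw [cls_rep] at this
    exact ⟨⟨⟨W, this⟩, i, x⟩, rfl⟩

/-- A point of `ofMult m`. -/
def ofMultMk (m : ConjClass G → ℕ) (W : ConjClass G) (i : Fin (m W)) (x : (coset W.rep).carrier) :
    (ofMult m).carrier := ⟨W, i, x⟩

variable {m : ConjClass G → ℕ} {W : ConjClass G} (i : Fin (m W)) (x : (coset W.rep).carrier)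

theorem exists_ofMultMk (y : (ofMult m).carrier) : ∃ W i x, ofMultMk m W i x = y :=
  ⟨y.1, y.2.1, y.2.2, rfl⟩

theorem ofMultMk_inj {y : (coset W.rep).carrier} :
    ofMultMk m W i x = ofMultMk m W i y ↔ x = y := by
  refine ⟨fun h => ?_, fun h => h ▸ rfl⟩
  exact congrArg Prod.snd (eq_of_heq (Sigma.mk.inj h).2)

theorem smul_ofMultMk (g : G) : g • ofMultMk m W i x = ofMultMk m W i (g • x) := rfl

theorem stab_ofMultMk : MulAction.stabilizer G (ofMultMk m W i x) = MulAction.stabilizer G x := by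
  ext g
  rw [MulAction.mem_stabilizer_iff, MulAction.mem_stabilizer_iff, smul_ofMultMk, ofMultMk_inj]

theorem ofMultMk_mem_fixed {U : OpenSubgroup G} :
    ofMultMk m W i x ∈ MulAction.fixedPoints U.toSubgroup (ofMult m).carrier ↔
      x ∈ MulAction.fixedPoints U.toSubgroup (coset W.rep).carrier := by
  rw [mem_fixed, mem_fixed]
  exact forall₂_congr fun g _ => by rw [smul_ofMultMk, ofMultMk_inj]

theorem mark_ofMult (q : ℤ) (m : ConjClass G → ℕ) (U : OpenSubgroup G) :
    mark q U (ofMult m) = zmul q (fun W => (m W : ℤ)) (cls U) := by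
  have hterm (W : Below (cls U)) : zeta q (cls U) W.1 * (m W.1 : ℤ) =
      ∑ p ∈ (Finset.univ : Finset (Fin (m W.1))) ×ˢ ((coset W.1.rep).finite_fixed U).toFinset,
        q ^ (U.toSubgroup.relIndex (MulAction.stabilizer G p.2) - 1) := by
    rw [Finset.sum_product]
    dsimp only
    rw [Finset.sum_const, Finset.card_univ, Fintype.card_fin, nsmul_eq_mul,
      mul_comm, ← mark_coset_rep, mark_rep_cls]
    rfl
  rw [zmul, Finset.sum_congr rfl fun W _ => hterm W, Finset.sum_sigma']
  refine (Finset.sum_bij (fun y _ => ofMultMk m y.1.1 y.2.1 y.2.2) ?_ ?_ ?_ ?_).symm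
  · rintro ⟨W, i, x⟩ h
    rw [Finset.mem_sigma, Finset.mem_product, Set.Finite.mem_toFinset] at h
    exact (Set.Finite.mem_toFinset _).2 (ofMultMk_mem_fixed _ _ |>.2 h.2.2)
  · rintro ⟨⟨W, hW⟩, y⟩ _ ⟨⟨W', hW'⟩, y'⟩ _ h
    have h1 : W = W' := congrArg Sigma.fst h
    subst h1
    have h2 : y = y' := eq_of_heq (Sigma.mk.inj h).2
    rw [h2]
  · intro y h
    obtain ⟨W, i, x, rfl⟩ := exists_ofMultMk y
    have hx := (ofMultMk_mem_fixed i x).1 ((Set.Finite.mem_toFinset _).1 h)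
    have hW := prec_of_mem_fixed_coset hx
    rw [cls_rep] at hW
    refine ⟨⟨⟨W, hW⟩, i, x⟩, ?_, rfl⟩
    rw [Finset.mem_sigma, Finset.mem_product, Set.Finite.mem_toFinset]
    exact ⟨Finset.mem_univ _, Finset.mem_univ _, hx⟩
  · rintro ⟨W, i, x⟩ _
    rw [stab_ofMultMk]

/-- Here ρ is any system of orbit representatives. The index type is left free so that both abstract
orbits and double cosets can serve. -/
theorem equiv_ofMult {X : AlmostFinite G} {I : Type*} (ρ : I → X.carrier)
    (hρ : ∀ x, ∃ i, ∃ g : G, g • ρ i = x) (hinj : ∀ i j, ∀ g : G, g • ρ i = ρ j → i = j) :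
    X ≈ ofMult fun W => Nat.card {i // cls (X.stab (ρ i)) = W} := by
  -- Each representative is moved inside its orbit until its stabilizer is exactly `W.rep`, so that
  -- its orbit becomes G/`W.rep`.
  have hy (W : ConjClass G) (i : {i // cls (X.stab (ρ i)) = W}) :
      ∃ y, X.stab y = W.rep ∧ ∃ g : G, y = g • ρ i.1 := by
    obtain ⟨g, hg⟩ := exists_conjOpen_rep (X.stab (ρ i.1))
    refine ⟨g⁻¹ • ρ i.1, ?_, g⁻¹, rfl⟩
    rw [stab_smul, hg, conjOpen_conjOpen, inv_mul_cancel, conjOpen_one, i.2]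
  choose y hst t ht using hy
  -- Distinct indices give distinct points fixed by `W.rep`, and these are finitely many. Without
  -- finiteness `Nat.card` would be the default 0, not the multiplicity.
  have hfin (W : ConjClass G) : Finite {i // cls (X.stab (ρ i)) = W} := by
    have := (X.finite_fixed W.rep).to_subtype
    refine Finite.of_injective (fun i => (⟨y W i, mem_fixed_iff_le.2 (hst W i).ge⟩ :
      MulAction.fixedPoints W.rep.toSubgroup X.carrier)) fun i j h => Subtype.ext ?_
    have h' : y W i = y W j := congrArg Subtype.val h
    rw [ht W i, ht W j, ← inv_smul_eq_iff, ← mul_smul] at h'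
    exact hinj _ _ _ h'
  let e (W : ConjClass G) := (Finite.equivFin {i // cls (X.stab (ρ i)) = W}).symm
  have hlift (W : ConjClass G) (k) (a b : G) :
      a • y W (e W k) = b • y W (e W k) ↔ a⁻¹ * b ∈ W.rep := by
    rw [← hst W (e W k), mem_stab, mul_smul, inv_smul_eq_iff, eq_comm]
  let f : (ofMult fun W => Nat.card {i // cls (X.stab (ρ i)) = W}).carrier → X.carrier :=
    fun p => Quotient.liftOn' p.2.2 (fun g : G => g • y p.1 (e p.1 p.2.1)) fun a b h =>
      (hlift _ _ a b).2 (QuotientGroup.leftRel_apply.1 h)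
  have hf (W k) (g : G) : f (ofMultMk _ W k (cosetMk _ g)) = g • y W (e W k) := rfl
  refine Setoid.symm ⟨Equiv.ofBijective f ⟨?_, ?_⟩, ?_⟩
  · intro p p' h
    obtain ⟨W, k, c, rfl⟩ := exists_ofMultMk p
    obtain ⟨W', k', c', rfl⟩ := exists_ofMultMk p'
    obtain ⟨a, rfl⟩ := cosetMk_surjective _ c
    obtain ⟨b, rfl⟩ := cosetMk_surjective _ c'
    rw [hf, hf] at h
    have hi : (e W k).1 = (e W' k').1 := by
      rw [ht, ht, ← mul_smul, ← mul_smul, ← inv_smul_eq_iff, ← mul_smul] at h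
      exact hinj _ _ _ h
    have hW : W = W' := by rw [← (e W k).2, ← (e W' k').2, hi]
    subst hW
    have hk : k = k' := (e W).injective (Subtype.ext hi)
    subst hk
    rw [cosetMk_eq_iff.2 ((hlift W k a b).1 h)]
  · intro x
    obtain ⟨i, g, rfl⟩ := hρ x
    refine ⟨ofMultMk _ _ ((e _).symm ⟨i, rfl⟩) (cosetMk _ (g * (t _ ⟨i, rfl⟩)⁻¹)), ?_⟩
    rw [hf, Equiv.apply_symm_apply, ht, ← mul_smul, inv_mul_cancel_right]
  · intro g p
    obtain ⟨W, k, c, rfl⟩ := exists_ofMultMk p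
    obtain ⟨a, rfl⟩ := cosetMk_surjective _ c
    exact mul_smul g a _

theorem exists_equiv_ofMult (X : AlmostFinite G) : ∃ m, X ≈ ofMult m := by
  refine ⟨_, equiv_ofMult (X := X) (I := MulAction.orbitRel.Quotient G X.carrier) Quotient.out
    (fun x => ⟨Quotient.mk _ x, ?_⟩) fun i j g h => ?_⟩
  · have := Quotient.mk_out (s := MulAction.orbitRel G X.carrier) x
    obtain ⟨g, hg⟩ := MulAction.orbitRel_apply.1 this
    exact ⟨g⁻¹, by rw [← hg]; exact inv_smul_smul g x⟩
  · rw [← Quotient.out_eq i, ← Quotient.out_eq j, eq_comm]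
    exact Quotient.sound (MulAction.orbitRel_apply.2 ⟨g, h⟩)

/-- One vector of multiplicities serves every twist q at once. -/
theorem exists_mark_eq (X : AlmostFinite G) :
    ∃ m : ConjClass G → ℕ, ∀ q U, mark q U X = zmul q (fun W => (m W : ℤ)) (cls U) := by
  obtain ⟨m, hm⟩ := exists_equiv_ofMult X
  exact ⟨m, fun q U => by rw [mark_congr q U _ _ hm, mark_ofMult]⟩

/-- The marks for a single q, even q = 0, suffice: the multiplicities are recovered by injectivity
of `zmul q` over ℤ. -/
theorem equiv_of_mark_eq (q : ℤ) {X Y : AlmostFinite G} (h : ∀ U, mark q U X = mark q U Y) :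
    X ≈ Y := by
  obtain ⟨m, hm⟩ := exists_equiv_ofMult X
  obtain ⟨n, hn⟩ := exists_equiv_ofMult Y
  have hmn : (fun W => (m W : ℤ)) = fun W => (n W : ℤ) := by
    refine zmul_injective (fun k hk a ha => ?_) q (funext fun U => ?_)
    · simpa [hk] using ha
    · rw [← cls_rep U, ← mark_ofMult, ← mark_ofMult, ← mark_congr q _ _ _ hm,
        ← mark_congr q _ _ _ hn, h]
  have : m = n := funext fun W => Nat.cast_injective (congrFun hmn W)
  exact Setoid.trans hm (this ▸ Setoid.symm hn)

end AlmostFinite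
-- Counting invariant colourings of stabilizers.
namespace AlmostFinite

section Colouring

variable {G : Type u} [Group G] [TopologicalSpace G] {n : ℕ} {U : OpenSubgroup G}
  {X : AlmostFinite G} {x : X.carrier}

/-- Left `U`-invariant maps on `G_x` are maps on the set of right cosets. -/
def colouringEquiv : Colouring n U X x ≃
    (Quotient (QuotientGroup.rightRel (U.toSubgroup.subgroupOf (MulAction.stabilizer G x))) →
      ZMod n) where
  toFun c q := Quotient.liftOn' q c.1 fun s t h =>
    (c.2 s t ⟨t * s⁻¹, Subgroup.mem_subgroupOf.1 (QuotientGroup.rightRel_apply.1 h),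
      by simp⟩).symm
  invFun f := ⟨fun s => f (Quotient.mk'' s), by
    rintro s t ⟨g, hg, ht⟩
    refine congrArg f (Quotient.sound' (QuotientGroup.rightRel_apply.2 ?_))
    rw [Subgroup.mem_subgroupOf, Subgroup.coe_mul, Subgroup.coe_inv, ht, mul_inv_rev,
      mul_inv_cancel_left]
    exact inv_mem hg⟩
  left_inv c := rfl
  right_inv f := funext fun q => Quotient.inductionOn' q fun s => rfl

theorem mark_eq_sum_subtype (q : ℤ) (U : OpenSubgroup G) (X : AlmostFinite G)
    [Fintype (MulAction.fixedPoints U.toSubgroup X.carrier)] :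
    mark q U X = ∑ x : MulAction.fixedPoints U.toSubgroup X.carrier,
      q ^ (U.toSubgroup.relIndex (MulAction.stabilizer G x.1) - 1) :=
  Finset.sum_subtype _ (fun _ => Set.Finite.mem_toFinset _) _

variable [IsTopologicalGroup G] [CompactSpace G]

theorem finite_rightRel_quotient (U : OpenSubgroup G) (H : Subgroup G) :
    Finite (Quotient (QuotientGroup.rightRel (U.toSubgroup.subgroupOf H))) := by
  have := OpenSubgroup.finiteIndex U
  have : (U.toSubgroup.subgroupOf H).FiniteIndex := inferInstance
  exact Finite.of_equiv _ (QuotientGroup.quotientRightRelEquivQuotientLeftRel _).symm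

theorem finite_colouring [NeZero n] : Finite (Colouring n U X x) := by
  have := finite_rightRel_quotient U (MulAction.stabilizer G x)
  exact Finite.of_equiv _ colouringEquiv.symm

theorem card_colouring [NeZero n] :
    Nat.card (Colouring n U X x) = n ^ U.toSubgroup.relIndex (MulAction.stabilizer G x) := by
  have := finite_rightRel_quotient U (MulAction.stabilizer G x)
  rw [Nat.card_congr colouringEquiv, Nat.card_fun, Nat.card_zmod,
    Nat.card_congr (QuotientGroup.quotientRightRelEquivQuotientLeftRel _)]
  rfl

theorem card_colouring_quotient [NeZero n] :
    Nat.card (Quotient (colouringSetoid n U X x)) =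
      n ^ (U.toSubgroup.relIndex (MulAction.stabilizer G x) - 1) := by
  -- Translation acts freely and the value at 1 normalizes it, so every class has exactly n members.
  -- Cancelling one factor n lowers the exponent by one, which needs the relative index to be
  -- nonzero.
  let f : Colouring n U X x → ZMod n × Quotient (colouringSetoid n U X x) := fun c =>
    (c.1 1, Quotient.mk _ c)
  have hf : Function.Bijective f := by
    constructor
    · intro c d h
      obtain ⟨a, ha⟩ := Quotient.exact (congrArg Prod.snd h)
      have h1 : c.1 1 = d.1 1 := congrArg Prod.fst h
      have h0 : a = 0 := by simpa [h1] using ha 1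
      exact Subtype.ext (funext fun s => by rw [ha, h0, zero_add])
    · rintro ⟨b, q⟩
      induction q using Quotient.inductionOn with
      | h c =>
        refine ⟨⟨fun s => b - c.1 1 + c.1 s, fun s t h =>
          congrArg (b - c.1 1 + ·) (c.2 s t h)⟩, ?_⟩
        refine Prod.ext (sub_add_cancel _ _) (Quotient.sound ⟨c.1 1 - b, fun s => ?_⟩)
        change c.1 s = c.1 1 - b + (b - c.1 1 + c.1 s)
        ring
  have h := Nat.card_congr (Equiv.ofBijective f hf)
  rw [card_colouring, Nat.card_prod, Nat.card_zmod] at h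
  obtain ⟨k, hk⟩ := Nat.exists_eq_succ_of_ne_zero
    (OpenSubgroup.relIndex_ne_zero U (MulAction.stabilizer G x))
  rw [hk, pow_succ'] at h
  rw [hk, Nat.succ_sub_one]
  exact (Nat.eq_of_mul_eq_mul_left (NeZero.pos n) h).symm

theorem mark_eq_colouredCount [NeZero n] (U : OpenSubgroup G) (X : AlmostFinite G) :
    mark n U X = X.colouredCount n U := by
  have := (X.finite_fixed U).to_subtype
  have := Fintype.ofFinite (MulAction.fixedPoints U.toSubgroup X.carrier)
  have (x : MulAction.fixedPoints U.toSubgroup X.carrier) :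
      Finite (Quotient (colouringSetoid n U X x.1)) := by
    have := finite_colouring (n := n) (U := U) (x := x.1)
    infer_instance
  rw [mark_eq_sum_subtype, colouredCount, Nat.card_sigma, Nat.cast_sum]
  refine Finset.sum_congr rfl fun x _ => ?_
  rw [card_colouring_quotient, Nat.cast_pow]

theorem card_sigma_colouring [NeZero n] (U : OpenSubgroup G) (X : AlmostFinite G) :
    (Nat.card (Σ x : MulAction.fixedPoints U.toSubgroup X.carrier, Colouring n U X x.1) : ℤ) =
      n * mark n U X := by
  have := (X.finite_fixed U).to_subtype
  have := Fintype.ofFinite (MulAction.fixedPoints U.toSubgroup X.carrier)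
  have (x : MulAction.fixedPoints U.toSubgroup X.carrier) : Finite (Colouring n U X x.1) :=
    finite_colouring
  rw [mark_eq_sum_subtype, Nat.card_sigma, Nat.cast_sum, Finset.mul_sum]
  refine Finset.sum_congr rfl fun x _ => ?_
  rw [card_colouring, Nat.cast_pow, ← pow_succ',
    Nat.sub_add_cancel (Nat.one_le_iff_ne_zero.2 (OpenSubgroup.relIndex_ne_zero U _))]

end Colouring

/-! ### A G-space whose fixed points are coloured cosets. -/

section ColourSpace

variable {G : Type u} [Group G] [TopologicalSpace G] [IsTopologicalGroup G] [CompactSpace G]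

/-- Colourings of the coset `x ∈ G/V` that are left invariant under `U`. -/
def IsCosetColouring {n : ℕ} (U V : OpenSubgroup G) (x : (coset V).carrier) (c : G → ZMod n) :
    Prop := (∀ s, cosetMk V s ≠ x → c s = 0) ∧ ∀ u ∈ U, ∀ s, c (u * s) = c s

open Classical in
/-- Colourings of the stabilizer of a point `x` of `G/V` are colourings of the coset `x ⊆ G`. -/
noncomputable def cosetColouringEquiv (n : ℕ) (U V : OpenSubgroup G) {x : (coset V).carrier}
    (hx : U ≤ (coset V).stab x) :
    {c : G → ZMod n // IsCosetColouring U V x c} ≃ Colouring n U (coset V) x := by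
  -- For x = gV the coset, as a subset of G, equals G_x·g. Right translation by g identifies it with
  -- G_x and commutes with left multiplication by U. Extension by 0 off the coset keeps all
  -- colourings in the one type G → ℤ/n.
  have hg := Function.surjInv_eq (cosetMk_surjective V) x
  set g := Function.surjInv (cosetMk_surjective V) x
  have hstab (s : G) : cosetMk V s = x ↔ s * g⁻¹ ∈ MulAction.stabilizer G x := by
    rw [MulAction.mem_stabilizer_iff, ← hg, smul_cosetMk, inv_mul_cancel_right]
  have hU (u : G) (hu : u ∈ U) (s : G) : cosetMk V (u * s) = x ↔ cosetMk V s = x := by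
    rw [← smul_cosetMk, smul_eq_iff_eq_inv_smul, mem_stab.1 (inv_mem (hx hu))]
  have hinv (c : MulAction.stabilizer G x → ZMod n)
      (hc : ∀ s t : MulAction.stabilizer G x, (∃ g ∈ U, (t : G) = g * s) → c t = c s)
      (u : G) (hu : u ∈ U) (s : G) :
      (if h : cosetMk V (u * s) = x then c ⟨u * s * g⁻¹, (hstab (u * s)).1 h⟩ else 0) =
        if h : cosetMk V s = x then c ⟨s * g⁻¹, (hstab s).1 h⟩ else 0 := by
    by_cases h : cosetMk V s = x
    · rw [dif_pos h, dif_pos ((hU u hu s).2 h)]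
      exact hc _ _ ⟨u, hu, mul_assoc _ _ _⟩
    · rw [dif_neg h, dif_neg (mt (hU u hu s).1 h)]
  exact
  { toFun := fun c => ⟨fun s => c.1 (s * g), fun s t ⟨u, hu, ht⟩ => by
      change c.1 (t * g) = c.1 (s * g)
      rw [ht, mul_assoc, c.2.2 u hu]⟩
    invFun := fun c => ⟨fun s => if h : cosetMk V s = x then c.1 ⟨s * g⁻¹, (hstab s).1 h⟩ else 0,
      fun s hs => dif_neg hs, hinv c.1 c.2⟩
    left_inv := fun c => Subtype.ext (funext fun s => by
      by_cases h : cosetMk V s = x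
      · simp [h]
      · simp [h, c.2.1 s h])
    right_inv := fun c => Subtype.ext (funext fun s => by
      have : cosetMk V (s * g) = x := (hstab _).2 (by simp)
      simp [this]) }

/-- The points of `G/V` together with a locally constant `ℤ/n`-colouring of that coset. -/
def ColourPoint (n : ℕ) (V : OpenSubgroup G) : Type u :=
  {p : (coset V).carrier × (G → ZMod n) // ∃ N : OpenSubgroup G, IsCosetColouring N V p.1 p.2}

theorem IsCosetColouring.smul {n : ℕ} {U V : OpenSubgroup G} {x : (coset V).carrier}
    {c : G → ZMod n} (h : IsCosetColouring U V x c) (g : G) :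
    IsCosetColouring (conjOpen g U) V (g • x) fun s => c (g⁻¹ * s) := by
  refine ⟨fun s hs => h.1 _ fun h' => hs ?_, fun u hu s => ?_⟩
  · rw [← h', smul_cosetMk, mul_inv_cancel_left]
  · change c (g⁻¹ * (u * s)) = c (g⁻¹ * s)
    rw [← h.2 _ (mem_conjOpen.1 hu) (g⁻¹ * s)]
    congr 1
    group

instance (n : ℕ) (V : OpenSubgroup G) : MulAction G (ColourPoint n V) where
  smul g p := ⟨(g • p.1.1, fun s => p.1.2 (g⁻¹ * s)), by
    obtain ⟨N, hN⟩ := p.2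
    exact ⟨_, hN.smul g⟩⟩
  one_smul p := Subtype.ext (Prod.ext (one_smul G _) (funext fun s => by
    change p.1.2 (1⁻¹ * s) = _
    rw [inv_one, one_mul]))
  mul_smul g h p := Subtype.ext (Prod.ext (mul_smul g h _) (funext fun s => by
    change p.1.2 ((g * h)⁻¹ * s) = p.1.2 (h⁻¹ * (g⁻¹ * s))
    rw [mul_inv_rev, mul_assoc]))

theorem mem_fixed_colourPoint {n : ℕ} {U V : OpenSubgroup G} {p : ColourPoint n V} :
    p ∈ MulAction.fixedPoints U.toSubgroup (ColourPoint n V) ↔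
      p.1.1 ∈ MulAction.fixedPoints U.toSubgroup (coset V).carrier ∧
        IsCosetColouring U V p.1.1 p.1.2 := by
  rw [mem_fixed, mem_fixed]
  have hp : ∀ s, cosetMk V s ≠ p.1.1 → p.1.2 s = 0 := p.2.choose_spec.1
  constructor
  · intro h
    refine ⟨fun u hu => congrArg (fun p : ColourPoint n V => p.1.1) (h u hu), hp, fun u hu s => ?_⟩
    have := congrFun (congrArg (fun p : ColourPoint n V => p.1.2) (h u hu)) (u * s)
    change p.1.2 (u⁻¹ * (u * s)) = _ at this
    rw [← this, inv_mul_cancel_left]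
  · rintro ⟨h, -, h'⟩ u hu
    exact Subtype.ext (Prod.ext (h u hu) (funext fun s => h' _ (inv_mem hu) s))

/-- The fixed points of `U` on `ColourPoint n V` are the `U`-invariant colourings. -/
noncomputable def fixedColourPointEquiv (n : ℕ) (U V : OpenSubgroup G) :
    MulAction.fixedPoints U.toSubgroup (ColourPoint n V) ≃
      Σ x : MulAction.fixedPoints U.toSubgroup (coset V).carrier,
        Colouring n U (coset V) x.1 where
  toFun p := ⟨⟨p.1.1.1, (mem_fixed_colourPoint.1 p.2).1⟩, cosetColouringEquiv n U V
    (mem_fixed_iff_le.1 (mem_fixed_colourPoint.1 p.2).1)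
    ⟨p.1.1.2, (mem_fixed_colourPoint.1 p.2).2⟩⟩
  invFun y := ⟨⟨(y.1.1, ((cosetColouringEquiv n U V (mem_fixed_iff_le.1 y.1.2)).symm y.2).1),
    ⟨U, ((cosetColouringEquiv n U V (mem_fixed_iff_le.1 y.1.2)).symm y.2).2⟩⟩,
    mem_fixed_colourPoint.2 ⟨y.1.2,
      ((cosetColouringEquiv n U V (mem_fixed_iff_le.1 y.1.2)).symm y.2).2⟩⟩
  left_inv p := Subtype.ext (Subtype.ext (by simp))
  right_inv y := by simp

/-- The almost finite `G`-space of locally constant `ℤ/n`-colourings of the cosets of `V`. -/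
def colourSpace (n : ℕ) [NeZero n] (V : OpenSubgroup G) : AlmostFinite G where
  carrier := ColourPoint n V
  isOpen_stabilizer p := by
    obtain ⟨N, hN⟩ := p.2
    refine Subgroup.isOpen_mono (H₁ := (N ⊓ (coset V).stab p.1.1).toSubgroup)
      (fun u hu => ?_) (N ⊓ (coset V).stab p.1.1).isOpen
    refine mem_fixed.1 (mem_fixed_colourPoint.2 ⟨mem_fixed_iff_le.2 ?_, hN.1, ?_⟩) u hu
    · exact inf_le_right
    · exact fun v hv => hN.2 v hv.1
  finite_fixed U := by
    have := ((coset V).finite_fixed U).to_subtype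
    have (x : MulAction.fixedPoints U.toSubgroup (coset V).carrier) :
        Finite (Colouring n U (coset V) x.1) := finite_colouring
    exact Set.finite_coe_iff.1 (Finite.of_equiv _ (fixedColourPointEquiv n U V).symm)

/-- The colourings are not taken modulo translation, whence the factor n. Taking translation classes
first would create extra fixed points: colourings that U moves by a translation. -/
theorem mark_colourSpace (n : ℕ) [NeZero n] (U V : OpenSubgroup G) :
    mark 1 U (colourSpace n V) = n * mark n U (coset V) := by
  rw [mark_one_left, ← card_sigma_colouring]
  exact congrArg _ (Nat.card_congr (fixedColourPointEquiv n U V))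

end ColourSpace
end AlmostFinite
-- Divisibility of marks by the index of U in its normalizer.
section Divisibility

variable {G : Type u} [Group G]

open AlmostFinite

theorem ncard_orbit_subgroup {X : Type*} [MulAction G X] (N : Subgroup G) (x : X) :
    (MulAction.orbit N x).ncard = (MulAction.stabilizer G x).relIndex N := by
  rw [← MulAction.index_stabilizer, Subgroup.relIndex]
  rfl

variable [TopologicalSpace G]

theorem smul_mem_fixed_of_mem_normalizer {X : Type*} [MulAction G X] {U : OpenSubgroup G}
    {x : X} (hx : x ∈ MulAction.fixedPoints U.toSubgroup X)
    (g : Subgroup.normalizer (U.toSubgroup : Set G)) :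
    g • x ∈ MulAction.fixedPoints U.toSubgroup X := by
  rw [mem_fixed] at *
  intro u hu
  have h := hx (g.1⁻¹ * u * g.1) ((Subgroup.mem_normalizer_iff''.1 g.2 u).1 hu)
  rw [mul_smul, mul_smul, inv_smul_eq_iff] at h
  exact h

variable [IsTopologicalGroup G] [CompactSpace G]

theorem phi_self_eq (U : ConjClass G) :
    phi U U = U.rep.toSubgroup.relIndex (Subgroup.normalizer (U.rep.toSubgroup : Set G)) := by
  have hst : MulAction.stabilizer G (cosetMk U.rep 1) = U.rep.toSubgroup := by
    change ((coset U.rep).stab (cosetMk U.rep 1)).toSubgroup = _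
    rw [stab_cosetMk, conjOpen_one]
  rw [← hst, ← ncard_orbit_subgroup, hst, phi]
  change Nat.card (MulAction.fixedPoints U.rep.toSubgroup (coset U.rep).carrier) = _
  rw [Nat.card_coe_set_eq]
  congr 1
  ext x
  constructor
  · intro hx
    obtain ⟨g, rfl⟩ := cosetMk_surjective _ x
    -- A fixed coset gU means U ≤ gUg⁻¹; equal indices force equality, so g normalizes U.
    have hg : U.rep = conjOpen g U.rep := by
      refine OpenSubgroup.eq_of_le_of_index_le ?_ (index_conjOpen g _).ge
      rw [← stab_cosetMk]
      exact mem_fixed_iff_le.1 hx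
    have hgN : g⁻¹ ∈ Subgroup.normalizer (U.rep.toSubgroup : Set G) :=
      Subgroup.mem_normalizer_iff.2 fun h => by
        change h ∈ U.rep ↔ g⁻¹ * h * g⁻¹⁻¹ ∈ U.rep
        rw [inv_inv, ← mem_conjOpen, ← hg]
    refine ⟨⟨g, by simpa using inv_mem hgN⟩, ?_⟩
    change g • cosetMk U.rep 1 = cosetMk U.rep g
    rw [smul_cosetMk, mul_one]
  · rintro ⟨g, rfl⟩
    refine smul_mem_fixed_of_mem_normalizer (mem_fixed_iff_le.2 ?_) g
    rw [stab_cosetMk, conjOpen_one]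

/-- N = N(U) acts on the U-fixed points of G/Y. The orbit of x has (N : N ∩ G_x) points, (Y:U) =
(G_x:U) is a multiple of (N ∩ G_x : U), and the product of these two indices is (N:U). So the claim
holds orbit by orbit. -/
theorem phi_self_dvd (U Y : ConjClass G) : phi U U ∣ phi U Y * idx Y U := by
  classical
  set N := Subgroup.normalizer (U.rep.toSubgroup : Set G)
  have hUN : U.rep.toSubgroup ≤ N := Subgroup.le_normalizer
  rw [phi_self_eq, card_fixed_coset_rep U Y, Finset.card_eq_sum_card_image
    (Quotient.mk (MulAction.orbitRel N (coset Y.rep).carrier)), Finset.sum_mul]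
  refine Finset.dvd_sum fun b hb => ?_
  obtain ⟨x, hx, rfl⟩ := Finset.mem_image.1 hb
  rw [Set.Finite.mem_toFinset] at hx
  have hfib : ((((coset Y.rep).finite_fixed U.rep).toFinset.filter fun y =>
      Quotient.mk (MulAction.orbitRel N (coset Y.rep).carrier) y = Quotient.mk _ x : Finset _) :
      Set (coset Y.rep).carrier) = MulAction.orbit N x := by
    ext y
    rw [Finset.mem_coe, Finset.mem_filter, Set.Finite.mem_toFinset, Quotient.eq,
      MulAction.orbitRel_apply]
    refine ⟨fun h => h.2, fun h => ⟨?_, h⟩⟩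
    obtain ⟨g, rfl⟩ := h
    exact smul_mem_fixed_of_mem_normalizer hx g
  rw [← Set.ncard_coe_finset, hfib, ncard_orbit_subgroup]
  have hle : U.rep.toSubgroup ≤ MulAction.stabilizer G x := mem_fixed_iff_le.1 hx
  obtain ⟨g, hg⟩ := exists_stab_coset Y.rep x
  have hidx : idx Y U = U.rep.toSubgroup.relIndex (MulAction.stabilizer G x) := by
    rw [relIndex_stab hx, hg, index_conjOpen, idx]
  rw [hidx, ← Subgroup.relIndex_mul_relIndex _ _ _ (le_inf hle hUN) inf_le_right,
    Subgroup.inf_relIndex_right, mul_comm]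
  refine mul_dvd_mul_left _ ?_
  exact Dvd.intro _ (Subgroup.relIndex_mul_relIndex _ _ _ (le_inf hle hUN) inf_le_left)

end Divisibility
-- Integrality of rational numbers, tested at each prime.
/-- The rational numbers whose denominator is prime to `p`. -/
def primeToSubring (p : ℕ) [hp : Fact p.Prime] : Subring ℚ where
  carrier := {r | ∃ s t : ℤ, ¬ (p : ℤ) ∣ s ∧ s * r = t}
  mul_mem' := by
    rintro a b ⟨s, t, hs, h⟩ ⟨s', t', hs', h'⟩
    refine ⟨s * s', t * t', fun hd => ?_, by push_cast; rw [← h, ← h']; ring⟩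
    exact ((Nat.prime_iff_prime_int.1 hp.out).dvd_or_dvd hd).elim hs hs'
  one_mem' := ⟨1, 1, (Nat.prime_iff_prime_int.1 hp.out).not_dvd_one, by simp⟩
  add_mem' := by
    rintro a b ⟨s, t, hs, h⟩ ⟨s', t', hs', h'⟩
    refine ⟨s * s', t * s' + t' * s, fun hd => ?_, by push_cast; rw [← h, ← h']; ring⟩
    exact ((Nat.prime_iff_prime_int.1 hp.out).dvd_or_dvd hd).elim hs hs'
  zero_mem' := ⟨1, 0, (Nat.prime_iff_prime_int.1 hp.out).not_dvd_one, by simp⟩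
  neg_mem' := by
    rintro a ⟨s, t, hs, h⟩
    exact ⟨s, -t, hs, by push_cast; rw [← h]; ring⟩

theorem inv_mem_primeToSubring {p : ℕ} [Fact p.Prime] {n : ℕ} (h : ¬ p ∣ n) :
    (n : ℚ)⁻¹ ∈ primeToSubring p := by
  refine ⟨n, 1, fun hd => h (Int.natCast_dvd_natCast.1 hd), ?_⟩
  have : (n : ℚ) ≠ 0 := by
    rintro h0
    exact h (by simp [Nat.cast_eq_zero.1 h0])
  simp [this]

/-- A prime factor of a nontrivial denominator would, by membership at that prime, also divide the
numerator. -/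
theorem exists_int_of_forall_mem {r : ℚ}
    (h : ∀ (p : ℕ) [Fact p.Prime], r ∈ primeToSubring p) : ∃ z : ℤ, r = z := by
  by_contra hr
  have hden : r.den ≠ 1 := fun h1 => hr ⟨r.num, (Rat.den_eq_one_iff r).1 h1 |>.symm⟩
  have : Fact r.den.minFac.Prime := ⟨Nat.minFac_prime hden⟩
  obtain ⟨s, t, hs, hst⟩ := h r.den.minFac
  have h1 : s * r.num = t * r.den := by
    have hd : (r.den : ℚ) ≠ 0 := by exact_mod_cast r.den_nz
    have : (s : ℚ) * r.num = t * r.den := by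
      rw [← hst, mul_assoc, Rat.mul_den_eq_num]
    exact_mod_cast this
  have h2 : (r.den.minFac : ℤ) ∣ s * r.num := by
    rw [h1]
    exact (Int.natCast_dvd_natCast.2 r.den.minFac_dvd).mul_left _
  refine ((Nat.prime_iff_prime_int.1 this.out).dvd_or_dvd h2).elim hs fun h3 => ?_
  have h4 := Nat.dvd_gcd (Int.natCast_dvd.1 h3) r.den.minFac_dvd
  rw [Nat.Coprime.gcd_eq_one r.reduced] at h4
  exact this.out.one_lt.ne' (Nat.dvd_one.1 h4)

/-! ### Integrality of the structure constants. -/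

section Integrality

variable {G : Type u} [Group G] [TopologicalSpace G] [IsTopologicalGroup G] [CompactSpace G]

open AlmostFinite

/-- Write (Y:U) = p^v·k with k prime to p. Multiplying by k clears the denominator: p^v divides
n^{(Y:U)-1}, so `phi_self_dvd` applies. -/
theorem zeta_div_phi_mem {p : ℕ} [hp : Fact p.Prime] {n : ℕ} (hpn : p ∣ n) (U Y : ConjClass G) :
    zeta (n : ℚ) U Y / phi U U ∈ primeToSubring p := by
  by_cases h : Prec Y U
  · have hk : idx Y U ≠ 0 := by
      obtain ⟨g, hg⟩ := prec_iff.1 h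
      have := Nat.le_of_dvd (Nat.pos_of_ne_zero (OpenSubgroup.index_ne_zero U.rep))
        (Subgroup.index_dvd_of_le hg)
      rw [index_conjOpen] at this
      exact (Nat.div_pos this (Nat.pos_of_ne_zero (OpenSubgroup.index_ne_zero _))).ne'
    obtain ⟨v, k, hpk, hvk⟩ := Nat.exists_eq_pow_mul_and_not_dvd hk p hp.out.ne_one
    -- From v < p^v ≤ (Y:U); this is where the exponent (Y:U) - 1 is just large enough.
    have hv : v ≤ idx Y U - 1 := by
      have h1 : p ^ v ≤ idx Y U := Nat.le_of_dvd (Nat.pos_of_ne_zero hk) ⟨k, hvk⟩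
      have h2 := Nat.lt_pow_self (n := v) hp.out.one_lt
      omega
    have hd : phi U U ∣ k * (phi U Y * n ^ (idx Y U - 1)) := by
      have h1 : phi U Y * idx Y U ∣ k * (phi U Y * n ^ (idx Y U - 1)) := by
        have e : phi U Y * idx Y U = k * (phi U Y * p ^ v) := by rw [hvk]; ring
        rw [e]
        exact mul_dvd_mul_left _ (mul_dvd_mul_left _ ((pow_dvd_pow p hv).trans
          (pow_dvd_pow_of_dvd hpn _)))
      exact (phi_self_dvd U Y).trans h1
    obtain ⟨t, ht⟩ := hd
    refine ⟨k, t, fun hd => hpk (Int.natCast_dvd_natCast.1 hd), ?_⟩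
    have hphi : (phi U U : ℚ) ≠ 0 := Nat.cast_ne_zero.2 (phi_self_pos U).ne'
    rw [zeta, if_pos h, mul_div_assoc', div_eq_iff hphi, mul_comm (((t : ℕ) : ℤ) : ℚ)]
    exact_mod_cast ht
  · rw [zeta_eq_zero _ h, zero_div]
    exact zero_mem _

/-- Row U divided by φ_U(G/U) has p-integral entries and diagonal 1, so substitution keeps the
solution p-integral. The case n = 0 is included, as every p divides 0. -/
theorem mem_primeToSubring_of_dvd {p : ℕ} [hp : Fact p.Prime] {n : ℕ} (hpn : p ∣ n)
    {V W : ConjClass G} {c : ConjClass G → ℚ}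
    (hc : zmul (n : ℚ) c = fun U => zeta (n : ℚ) U V * zeta (n : ℚ) U W) (U : ConjClass G) :
    c U ∈ primeToSubring p := by
  classical
  induction U using ConjClass.induction with
  | h U ih =>
    have hphi : (phi U U : ℚ) ≠ 0 := Nat.cast_ne_zero.2 (phi_self_pos U).ne'
    have hzeta (Y : ConjClass G) : zeta (n : ℚ) U Y ∈ primeToSubring p := by
      rw [← div_mul_cancel₀ (zeta (n : ℚ) U Y) hphi]
      exact mul_mem (zeta_div_phi_mem hpn U Y) (natCast_mem _ _)
    have h := congrFun hc U
    rw [zmul_eq] at h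
    have h' : c U = zeta (n : ℚ) U V / phi U U * zeta (n : ℚ) U W -
        ∑ Y : Below U, if Y.1 = U then 0 else zeta (n : ℚ) U Y.1 / phi U U * c Y.1 := by
      rw [eq_sub_iff_add_eq, ← mul_left_inj' hphi, add_mul, mul_comm (c U), Finset.sum_mul,
        mul_right_comm, div_mul_cancel₀ _ hphi, ← h]
      refine congrArg _ (Finset.sum_congr rfl fun Y _ => ?_)
      split_ifs
      · rw [zero_mul]
      · rw [mul_right_comm, div_mul_cancel₀ _ hphi]
    rw [h']
    refine sub_mem (mul_mem (zeta_div_phi_mem hpn U V) (hzeta W)) (sum_mem fun Y _ => ?_)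
    split_ifs with hY
    · exact zero_mem _
    · exact mul_mem (zeta_div_phi_mem hpn U Y.1) (ih Y.1 Y.2 hY)

theorem int_mul_eq_zero (n : ℕ) (hn : n ≠ 0) (a : ℤ) (h : (n : ℤ) * a = 0) : a = 0 := by
  simpa [hn] using h

/-- The coefficients of `n ζ_G^n` in terms of the table of marks. -/
theorem exists_zmul_one_eq (n : ℕ) [NeZero n] (W : ConjClass G) :
    ∃ m : ConjClass G → ℤ, (∀ U, zmul 1 m U = n * zeta (n : ℤ) U W) ∧
      (∀ Y, ¬ Prec W Y → m Y = 0) ∧ m W = n := by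
  classical
  obtain ⟨m, hm⟩ := exists_mark_eq (colourSpace n W.rep)
  have h1 (U : ConjClass G) : zmul 1 (fun W => (m W : ℤ)) U = n * zeta (n : ℤ) U W := by
    rw [← cls_rep U, ← hm, mark_colourSpace, mark_coset_rep, cls_rep]
  have h2 (Y : ConjClass G) (hY : ¬ Prec W Y) : (m Y : ℤ) = 0 := by
    refine zmul_eq_zero_below int_mul_eq_zero 1 (x := fun W => (m W : ℤ)) Y fun V hV => ?_
    rw [h1, zeta_eq_zero _ fun h => hY (h.trans hV), mul_zero]
  refine ⟨fun W => m W, h1, h2, ?_⟩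
  -- By the support of m, row W retains only its diagonal term, and φ_W(G/W) cancels.
  have h3 := h1 W
  rw [zmul_eq, Finset.sum_eq_zero, add_zero, zeta_self, mul_comm] at h3
  · exact mul_right_cancel₀ (Nat.cast_ne_zero.2 (phi_self_pos W).ne') h3
  · intro Y _
    split_ifs with hY
    · rfl
    · rw [h2 Y.1 fun h => hY (Y.2.antisymm h), mul_zero]

theorem exists_zmul_one_eq_mul (n : ℕ) [NeZero n] (V W : ConjClass G) :
    ∃ m : ConjClass G → ℤ, ∀ U, zmul 1 m U =
      (n * zeta (n : ℤ) U V) * (n * zeta (n : ℤ) U W) := by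
  obtain ⟨m, hm⟩ := exists_mark_eq ((colourSpace n V.rep).prod (colourSpace n W.rep))
  refine ⟨fun W => m W, fun U => ?_⟩
  rw [← cls_rep U, ← hm, mark_one_prod, mark_colourSpace, mark_colourSpace, mark_coset_rep,
    mark_coset_rep, cls_rep]

/-- Both n·(column of `ζ_G^n`) and the product of two such have integral coordinates in the columns
of `ζ_G^1`. Comparing them gives a triangular system for c with integral data and diagonal n², a
unit at p. -/
theorem mem_primeToSubring_of_not_dvd {p : ℕ} [hp : Fact p.Prime] {n : ℕ} (hpn : ¬ p ∣ n)
    {V W : ConjClass G} {c : ConjClass G → ℚ}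
    (hc : zmul (n : ℚ) c = fun U => zeta (n : ℚ) U V * zeta (n : ℚ) U W) (U : ConjClass G) :
    c U ∈ primeToSubring p := by
  classical
  have hn : n ≠ 0 := by
    rintro rfl
    exact hpn (dvd_zero p)
  have : NeZero n := ⟨hn⟩
  have hnQ : (n : ℚ) ≠ 0 := Nat.cast_ne_zero.2 hn
  obtain ⟨N, hN⟩ := exists_zmul_one_eq_mul n V W
  choose m hm hm0 hmn using exists_zmul_one_eq (G := G) n
  -- Both sides have the same image under `zmul 1`, namely n² times the product of columns V and W
  -- of `ζ_G^n`, so injectivity over ℚ applies.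
  have hN' (Y : ConjClass G) : (N Y : ℚ) = n * ∑ W : Below Y, (m W.1 Y : ℚ) * c W.1 := by
    refine congrFun (zmul_injective (R := ℚ) (fun k hk a ha => ?_) 1
      (a₁ := fun Y => (N Y : ℚ))
      (a₂ := fun Y => n * ∑ W : Below Y, (m W.1 Y : ℚ) * c W.1) (funext fun U => ?_)) Y
    · simpa [hk] using ha
    · have h1 := map_zmul (Int.castRingHom ℚ) 1 N U
      have h2 (W : ConjClass G) := map_zmul (Int.castRingHom ℚ) 1 (m W) U
      have hz (W : ConjClass G) : ((zeta (n : ℤ) U W : ℤ) : ℚ) = zeta (n : ℚ) U W :=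
        map_zeta (Int.castRingHom ℚ) n U W
      simp only [hN, hm, map_mul, map_natCast, map_one, eq_intCast, hz] at h1 h2
      rw [← h1, mul_mul_mul_comm, ← congrFun hc U, zmul, zmul, mul_assoc, Finset.mul_sum]
      simp only [← mul_assoc, h2]
      have h3 (Y : Below U) : ∑ W : Below Y.1, (m W.1 Y.1 : ℚ) * c W.1 =
          ∑ W : Below U, (m W.1 Y.1 : ℚ) * c W.1 :=
        sum_below_mono Y.2 (fun W => (m W Y.1 : ℚ) * c W) fun W hW => by
          rw [hm0 _ _ hW, Int.cast_zero, zero_mul]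
      simp only [h3, zmul, Finset.sum_mul, Finset.mul_sum]
      rw [Finset.sum_comm]
      refine Finset.sum_congr rfl fun Y _ => Finset.sum_congr rfl fun W _ => ?_
      ring
  induction U using ConjClass.induction with
  | h U ih =>
    have h := hN' U
    rw [sum_below_eq U fun W => (m W U : ℚ) * c W, hmn] at h
    have h' : c U = (n : ℚ)⁻¹ * ((n : ℚ)⁻¹ * N U -
        ∑ W : Below U, if W.1 = U then 0 else (m W.1 U : ℚ) * c W.1) := by
      rw [h, inv_mul_cancel_left₀ hnQ, add_sub_cancel_right, Int.cast_natCast,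
        inv_mul_cancel_left₀ hnQ]
    rw [h']
    have hinv := inv_mem_primeToSubring hpn
    refine mul_mem hinv (sub_mem (mul_mem hinv (intCast_mem _ _)) (sum_mem fun Y _ => ?_))
    split_ifs with hY
    · exact zero_mem _
    · exact mul_mem (intCast_mem _ _) (ih Y.1 Y.2 hY)

theorem exists_int_eq_of_zmul_eq {n : ℕ} {V W : ConjClass G} {c : ConjClass G → ℚ}
    (hc : zmul (n : ℚ) c = fun U => zeta (n : ℚ) U V * zeta (n : ℚ) U W) (U : ConjClass G) :
    ∃ z : ℤ, c U = z := by
  refine exists_int_of_forall_mem fun p _ => ?_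
  by_cases h : p ∣ n
  · exact mem_primeToSubring_of_dvd h hc U
  · exact mem_primeToSubring_of_not_dvd h hc U

/-- A polynomial with integer values at the natural numbers has integer values on `ℤ`. -/
theorem exists_int_eval {P : Polynomial ℚ} (h : ∀ n : ℕ, ∃ z : ℤ, P.eval (n : ℚ) = z) (q : ℤ) :
    ∃ z : ℤ, P.eval (q : ℚ) = z := by
  obtain ⟨b, hbm, hb⟩ := IsLocalization.integerNormalization_spec (nonZeroDivisors ℤ) P
  set Q := IsLocalization.integerNormalization (nonZeroDivisors ℤ) P
  have hb0 : b ≠ 0 := nonZeroDivisors.ne_zero hbm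
  have hQ (a : ℤ) : ((Q.eval a : ℤ) : ℚ) = b * P.eval (a : ℚ) := by
    have := congrArg (Polynomial.eval (a : ℚ)) hb
    rw [Polynomial.eval_smul] at this
    rw [← eq_intCast (algebraMap ℤ ℚ) (Q.eval a), ← Polynomial.eval_map_apply]
    simpa using this
  -- A natural number congruent to q modulo b², nonnegative since b² ≥ 1 and q² ≥ -q. For Q = bP in
  -- ℤ[t], Q(N) - Q(q) is divisible by b²q², so P(N) - P(q) is an integer.
  let N : ℕ := (q + b * (b * q ^ 2)).toNat
  have hN : (N : ℤ) = q + b * (b * q ^ 2) := by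
    refine Int.toNat_of_nonneg ?_
    have h1 : 0 < b ^ 2 := by positivity
    nlinarith [mul_le_mul_of_nonneg_right (Int.add_one_le_iff.2 h1) (sq_nonneg q),
      Int.le_self_sq (-q)]
  obtain ⟨z, hz⟩ := h N
  obtain ⟨k, hk⟩ := (Polynomial.sub_dvd_eval_sub (N : ℤ) q Q)
  have h1 := congrArg (Int.cast : ℤ → ℚ) hk
  have hNq : (N : ℤ) - q = b * (b * q ^ 2) := by rw [hN]; ring
  rw [hNq] at h1
  push_cast [hQ] at h1
  refine ⟨z - b * q ^ 2 * k, ?_⟩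
  have hbQ : (b : ℚ) ≠ 0 := Int.cast_ne_zero.2 hb0
  refine mul_left_cancel₀ hbQ ?_
  push_cast
  rw [← hz]
  linear_combination -h1

end Integrality
-- The structure polynomials and their integer values.
section StructurePoly

variable {G : Type u} [Group G] [TopologicalSpace G] [IsTopologicalGroup G] [CompactSpace G]

theorem isUnit_natCast_polynomial (n : ℕ) (hn : n ≠ 0) : IsUnit (n : Polynomial ℚ) := by
  rw [← Polynomial.C_eq_natCast]
  exact Polynomial.isUnit_C.2 (IsUnit.mk0 _ (Nat.cast_ne_zero.2 hn))

-- Solving for each standard basis vector over ℚ[t] yields the columns of a right inverse; a square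
-- matrix with a right inverse is invertible, so the `⁻¹` in `mu` is a genuine inverse.
open Classical in
theorem mu_mul_zeta (U : ConjClass G) :
    mu U * (Matrix.of fun V W : Below U => zeta (Polynomial.X : Polynomial ℚ) V.1 W.1) = 1 := by
  have hs (W : ConjClass G) := zmul_surjective isUnit_natCast_polynomial
    (Polynomial.X : Polynomial ℚ) fun Z : ConjClass G => if Z = W then 1 else 0
  choose b hb using hs
  have hb0 (W Y : ConjClass G) (h : ¬ Prec W Y) : b W Y = 0 := by
    refine zmul_eq_zero_below (fun n hn a ha => ?_) Polynomial.X (x := b W) Y fun V hV => ?_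
    · exact (isUnit_natCast_polynomial n hn).mul_right_eq_zero.1 ha
    · rw [hb]
      exact if_neg fun h' : V = W => h (h' ▸ hV)
  refine Matrix.nonsing_inv_mul _ (Matrix.isUnit_det_of_right_inverse
    (B := Matrix.of fun Y W : Below U => b W.1 Y.1) ?_)
  ext Z W : 2
  rw [Matrix.mul_apply, Matrix.one_apply]
  have h := congrFun (hb W.1) Z.1
  rw [zmul, sum_below_mono Z.2 fun Y => zeta Polynomial.X Z.1 Y * b W.1 Y] at h
  · simp only [Matrix.of_apply, h, Subtype.ext_iff]
  · intro Y hY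
    rw [zeta_eq_zero _ hY, zero_mul]

/-- Each `mu U` inverts a different finite block. Comparison with one global solution c shows that
the resulting values fit together as U varies. -/
theorem structurePoly_eq {V W : ConjClass G} {c : ConjClass G → Polynomial ℚ}
    (hc : zmul Polynomial.X c = fun U =>
      zeta (Polynomial.X : Polynomial ℚ) U V * zeta Polynomial.X U W) (U : ConjClass G) :
    structurePoly V W U = c U := by
  classical
  have h1 : (Matrix.of fun V W : Below U => zeta (Polynomial.X : Polynomial ℚ) V.1 W.1).mulVec
      (fun Y => c Y.1) = fun Z : Below U => zeta Polynomial.X Z.1 V * zeta Polynomial.X Z.1 W := by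
    funext Z
    rw [← congrFun hc Z.1, zmul, sum_below_mono Z.2 fun Y => zeta Polynomial.X Z.1 Y * c Y]
    · rfl
    · intro Y hY
      rw [zeta_eq_zero _ hY, zero_mul]
  have h2 := congrArg (fun v => (mu U).mulVec v (Below.top U)) h1
  simp only [Matrix.mulVec_mulVec, mu_mul_zeta, Matrix.one_mulVec] at h2
  exact h2.symm

theorem zmul_structurePoly (V W : ConjClass G) :
    zmul Polynomial.X (structurePoly V W) = fun U =>
      zeta (Polynomial.X : Polynomial ℚ) U V * zeta Polynomial.X U W := by
  obtain ⟨c, hc⟩ := zmul_surjective isUnit_natCast_polynomial (Polynomial.X : Polynomial ℚ)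
    fun U : ConjClass G => zeta (Polynomial.X : Polynomial ℚ) U V * zeta Polynomial.X U W
  rw [← hc]
  exact congrArg _ (funext (structurePoly_eq hc))

theorem structurePoly_eq_zero {V W U : ConjClass G} (h : ¬ (Prec V U ∧ Prec W U)) :
    structurePoly V W U = 0 := by
  refine Finset.sum_eq_zero fun Z _ => ?_
  by_cases hV : Prec V Z.1
  · rw [zeta_eq_zero _ fun hW => h ⟨hV.trans Z.2, Prec.trans hW Z.2⟩, mul_zero, mul_zero]
  · rw [zeta_eq_zero _ hV, zero_mul, mul_zero]

theorem zmul_eval_structurePoly (q : ℚ) (V W : ConjClass G) :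
    zmul q (fun U => (structurePoly V W U).eval q) = fun U => zeta q U V * zeta q U W := by
  funext U
  have h := map_zmul (Polynomial.evalRingHom q) Polynomial.X (structurePoly V W) U
  rw [zmul_structurePoly, map_mul, map_zeta, map_zeta, Polynomial.coe_evalRingHom,
    Polynomial.eval_X] at h
  exact h.symm

theorem exists_int_eval_structurePoly (q : ℤ) (V W U : ConjClass G) :
    ∃ z : ℤ, (structurePoly V W U).eval (q : ℚ) = z :=
  exists_int_eval (fun n => exists_int_eq_of_zmul_eq (zmul_eval_structurePoly (n : ℚ) V W) U) q

/-- The integer `P_{V,W}^U(q)`. -/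
noncomputable def structureInt (q : ℤ) (V W U : ConjClass G) : ℤ :=
  (exists_int_eval_structurePoly q V W U).choose

theorem structureInt_cast (q : ℤ) (V W U : ConjClass G) :
    (structureInt q V W U : ℚ) = (structurePoly V W U).eval (q : ℚ) :=
  (exists_int_eval_structurePoly q V W U).choose_spec.symm

theorem structureInt_eq_zero (q : ℤ) {V W U : ConjClass G} (h : ¬ (Prec V U ∧ Prec W U)) :
    structureInt q V W U = 0 := by
  have := structureInt_cast q V W U
  rw [structurePoly_eq_zero h, Polynomial.eval_zero] at this
  exact_mod_cast this

theorem zmul_structureInt (q : ℤ) (V W : ConjClass G) :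
    zmul q (structureInt q V W) = fun U => zeta q U V * zeta q U W := by
  funext U
  have h := map_zmul (Int.castRingHom ℚ) q (structureInt q V W) U
  simp only [eq_intCast, structureInt_cast, zmul_eval_structurePoly] at h
  have hz (W : ConjClass G) : ((zeta q U W : ℤ) : ℚ) = zeta (q : ℚ) U W :=
    map_zeta (Int.castRingHom ℚ) q U W
  rw [← hz, ← hz] at h
  exact_mod_cast h

end StructurePoly

/-! ### The necklace functor: existence and uniqueness. -/

section Necklace

variable {G : Type u} [Group G] [TopologicalSpace G]

/-- The componentwise sum. -/
def necklaceAdd {A : Type v} [CommRing A] (x y : NrSet G A) : NrSet G A := fun U => x U + y U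

theorem map_necklaceAdd {A B : Type v} [CommRing A] [CommRing B] (f : A →+* B)
    (x y : NrSet G A) :
    NrSet.map f (necklaceAdd x y) = necklaceAdd (NrSet.map f x) (NrSet.map f y) := by
  funext U
  simp [NrSet.map, necklaceAdd]

/-- The universal ring mapping onto `A`. -/
abbrev Cover (A : Type v) : Type v := MvPolynomial A ℤ

theorem cover_torsionFree (A : Type v) (n : ℕ) (hn : n ≠ 0) (a : Cover A)
    (h : (n : Cover A) * a = 0) : a = 0 :=
  (mul_eq_zero.1 h).resolve_left (Nat.cast_ne_zero.2 hn)

/-- Evaluation of the universal ring. -/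
noncomputable def Cover.eval (A : Type v) [CommRing A] : Cover A →+* A :=
  (MvPolynomial.aeval (id : A → A)).toRingHom

theorem exists_cover {A : Type v} [CommRing A] (x : NrSet G A) :
    ∃ x' : NrSet G (Cover A), NrSet.map (Cover.eval A) x' = x :=
  ⟨fun U => MvPolynomial.X (x U), funext fun U => by simp [NrSet.map, Cover.eval]⟩

variable [IsTopologicalGroup G] [CompactSpace G]

/-- The product of `A^{𝒪(G)}` with structure constants `P_{V,W}^U(q)`. -/
noncomputable def necklaceMul (q : ℤ) {A : Type v} [CommRing A] (x y : NrSet G A) : NrSet G A :=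
  fun U => ∑ V : Below U, ∑ W : Below U, (structureInt q V.1 W.1 U : A) * (x V.1 * y W.1)

theorem ghost_necklaceAdd (q : ℤ) {A : Type v} [CommRing A] (x y : NrSet G A) :
    ghost q (necklaceAdd x y) = ghost q x + ghost q y := zmul_add (q : A) x y

/-- By bilinearity this reduces to basis vectors, that is to `zmul_structureInt`. Vanishing of the
structure constants outside the order lets all inner sums run over `Below Z`. -/
theorem ghost_necklaceMul (q : ℤ) {A : Type v} [CommRing A] (x y : NrSet G A) :
    ghost q (necklaceMul q x y) = ghost q x * ghost q y := by
  funext Z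
  have h1 (U : Below Z) : necklaceMul q x y U.1 =
      ∑ V : Below Z, ∑ W : Below Z, (structureInt q V.1 W.1 U.1 : A) * (x V.1 * y W.1) := by
    rw [necklaceMul, sum_below_mono U.2 fun V => ∑ W : Below U.1,
      (structureInt q V W.1 U.1 : A) * (x V * y W.1)]
    · refine Finset.sum_congr rfl fun V _ => ?_
      refine sum_below_mono U.2 (fun W => (structureInt q V.1 W U.1 : A) * (x V.1 * y W))
        fun W hW => ?_
      rw [structureInt_eq_zero q fun h => hW h.2, Int.cast_zero, zero_mul]
    · intro V hV
      refine Finset.sum_eq_zero fun W _ => ?_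
      rw [structureInt_eq_zero q fun h => hV h.1, Int.cast_zero, zero_mul]
  have h2 (V W : ConjClass G) : ∑ U : Below Z, zeta (q : A) Z U.1 * (structureInt q V W U.1 : A) =
      zeta (q : A) Z V * zeta (q : A) Z W := by
    have h := map_zmul (Int.castRingHom A) q (structureInt q V W) Z
    rw [zmul_structureInt, map_mul, map_zeta, map_zeta] at h
    exact h.symm
  have h3 : ghost q (necklaceMul q x y) Z = ∑ V : Below Z, ∑ W : Below Z,
      (∑ U : Below Z, zeta (q : A) Z U.1 * (structureInt q V.1 W.1 U.1 : A)) *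
        (x V.1 * y W.1) := by
    simp only [ghost, h1, Finset.mul_sum, Finset.sum_mul]
    rw [Finset.sum_comm]
    refine Finset.sum_congr rfl fun V _ => ?_
    rw [Finset.sum_comm]
    refine Finset.sum_congr rfl fun W _ => Finset.sum_congr rfl fun U _ => ?_
    ring
  rw [h3, Pi.mul_apply, ghost, ghost, Finset.sum_mul_sum]
  simp only [h2]
  refine Finset.sum_congr rfl fun V _ => Finset.sum_congr rfl fun W _ => ?_
  ring

theorem map_necklaceMul (q : ℤ) {A B : Type v} [CommRing A] [CommRing B] (f : A →+* B)
    (x y : NrSet G A) :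
    NrSet.map f (necklaceMul q x y) = necklaceMul q (NrSet.map f x) (NrSet.map f y) := by
  funext U
  simp [NrSet.map, necklaceMul]

theorem ghost_injective (q : ℤ) {A : Type v} [CommRing A]
    (hA : ∀ n : ℕ, n ≠ 0 → ∀ a : A, (n : A) * a = 0 → a = 0) :
    Function.Injective (ghost q : NrSet G A → ConjClass G → A) :=
  zmul_injective hA (q : A)

theorem ghost_cover_injective (q : ℤ) (A : Type v) :
    Function.Injective (ghost q : NrSet G (Cover A) → ConjClass G → Cover A) :=
  ghost_injective q (cover_torsionFree A)

theorem necklaceMul_comm (q : ℤ) {A : Type v} [CommRing A] (x y : NrSet G A) :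
    necklaceMul q x y = necklaceMul q y x := by
  obtain ⟨x, rfl⟩ := exists_cover x
  obtain ⟨y, rfl⟩ := exists_cover y
  rw [← map_necklaceMul, ← map_necklaceMul]
  refine congrArg _ (ghost_cover_injective q A ?_)
  rw [ghost_necklaceMul, ghost_necklaceMul, mul_comm]

/-- Over `Cover A` the ghost map is injective and multiplicative, so associativity is inherited from
the product ring; it then passes to A by naturality of the product. -/
theorem necklaceMul_assoc (q : ℤ) {A : Type v} [CommRing A] (x y z : NrSet G A) :
    necklaceMul q (necklaceMul q x y) z = necklaceMul q x (necklaceMul q y z) := by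
  obtain ⟨x, rfl⟩ := exists_cover x
  obtain ⟨y, rfl⟩ := exists_cover y
  obtain ⟨z, rfl⟩ := exists_cover z
  simp only [← map_necklaceMul]
  refine congrArg _ (ghost_cover_injective q A ?_)
  simp only [ghost_necklaceMul, mul_assoc]

theorem necklaceMul_add (q : ℤ) {A : Type v} [CommRing A] (x y z : NrSet G A) :
    necklaceMul q x (necklaceAdd y z) = necklaceAdd (necklaceMul q x y) (necklaceMul q x z) := by
  funext U
  simp [necklaceMul, necklaceAdd, mul_add, Finset.sum_add_distrib]

/-- The `q`-necklace ring of `G` over `A`. -/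
@[reducible]
noncomputable def necklaceRing (q : ℤ) (A : Type v) [CommRing A] :
    NonUnitalCommRing (NrSet G A) where
  toAddCommGroup := (inferInstance : AddCommGroup (ConjClass G → A))
  mul := necklaceMul q
  mul_assoc := necklaceMul_assoc q
  mul_comm := necklaceMul_comm q
  left_distrib := necklaceMul_add q
  right_distrib x y z := (necklaceMul_comm q _ _).trans ((necklaceMul_add q z x y).trans
    (congrArg₂ necklaceAdd (necklaceMul_comm q _ _) (necklaceMul_comm q _ _)))
  zero_mul x := funext fun U => Finset.sum_eq_zero fun V _ => Finset.sum_eq_zero fun W _ => by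
    change _ * ((0 : A) * _) = 0
    rw [zero_mul, mul_zero]
  mul_zero x := funext fun U => Finset.sum_eq_zero fun V _ => Finset.sum_eq_zero fun W _ => by
    change _ * (_ * (0 : A)) = 0
    rw [mul_zero, mul_zero]

theorem isNecklaceFunctor_necklaceRing (q : ℤ) :
    IsNecklaceFunctor (G := G) q fun (A : Type v) [CommRing A] => necklaceRing q A where
  map_add := map_necklaceAdd
  map_mul := map_necklaceMul q
  ghost_add := ghost_necklaceAdd q
  ghost_mul := ghost_necklaceMul q

/-- Over `Cover A` the ghost map forces both operations, and the surjection onto A transports this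
by functoriality. -/
theorem IsNecklaceFunctor.unique {q : ℤ}
    {S T : ∀ (A : Type v) [CommRing A], NonUnitalCommRing (NrSet G A)}
    (hS : IsNecklaceFunctor q S) (hT : IsNecklaceFunctor q T) : S = T := by
  funext A _
  refine NonUnitalCommRing.ext (funext fun x => funext fun y => ?_)
    (funext fun x => funext fun y => ?_)
  all_goals
    obtain ⟨x, rfl⟩ := exists_cover x
    obtain ⟨y, rfl⟩ := exists_cover y
  · refine (hS.map_add _ _ _).symm.trans (Eq.trans (congrArg _ ?_) (hT.map_add _ _ _))
    exact ghost_cover_injective q A ((hS.ghost_add _ _).trans (hT.ghost_add _ _).symm)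
  · refine (hS.map_mul _ _ _).symm.trans (Eq.trans (congrArg _ ?_) (hT.map_mul _ _ _))
    exact ghost_cover_injective q A ((hS.ghost_mul _ _).trans (hT.ghost_mul _ _).symm)

theorem existsUnique_isNecklaceFunctor (q : ℤ) :
    ∃! S : ∀ (A : Type v) [CommRing A], NonUnitalCommRing (NrSet G A), IsNecklaceFunctor q S :=
  ⟨_, isNecklaceFunctor_necklaceRing q,
    fun _ hS => hS.unique (isNecklaceFunctor_necklaceRing q)⟩

end Necklace
-- The twisted Burnside ring and its identification over ℤ.
section Burnside

variable {G : Type u} [Group G] [TopologicalSpace G]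

theorem twistedMark_burnsideClass (q : ℤ) (U : OpenSubgroup G) (X : AlmostFinite G) :
    twistedMark q U (burnsideClass X) = X.mark q U :=
  DFunLike.congr_fun (Algebra.GrothendieckAddGroup.lift.symm_apply_apply (IsoClass.mark q U))
    (Quotient.mk _ X : IsoClass G)

theorem exists_burnsideClass_sub (a : BurnsideGroup G) :
    ∃ X Y : AlmostFinite G, a = burnsideClass X - burnsideClass Y := by
  obtain ⟨⟨m, s⟩, h⟩ := (AddLocalization.addMonoidOf (⊤ : AddSubmonoid (IsoClass G))).surj a
  obtain ⟨X, rfl⟩ := Quotient.exists_rep m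
  obtain ⟨Y, hY⟩ := Quotient.exists_rep s.1
  refine ⟨X, Y, eq_sub_of_add_eq ?_⟩
  rw [← hY] at h
  exact h

theorem burnsideClass_eq {X Y : AlmostFinite G} (h : X ≈ Y) :
    burnsideClass X = burnsideClass Y :=
  congrArg (Algebra.GrothendieckAddGroup.of (M := IsoClass G)) (Quotient.sound h)

variable [IsTopologicalGroup G] [CompactSpace G]

/-- If a - b = [X] - [Y], then X and Y have equal marks, hence are isomorphic. -/
theorem twistedMark_injective (q : ℤ) {a b : BurnsideGroup G}
    (h : ∀ U, twistedMark q U a = twistedMark q U b) : a = b := by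
  obtain ⟨X, Y, hXY⟩ := exists_burnsideClass_sub (a - b)
  have h0 : burnsideClass X = burnsideClass Y := by
    refine burnsideClass_eq (AlmostFinite.equiv_of_mark_eq q fun U => ?_)
    rw [← twistedMark_burnsideClass, ← twistedMark_burnsideClass, ← sub_eq_zero, ← map_sub,
      ← hXY, map_sub, h, sub_self]
  rw [h0, sub_self, sub_eq_zero] at hXY
  exact hXY

/-- The element `∑ x_V [G/V]` of `Ω̂(G)`. -/
noncomputable def burnsideSum (x : NrSet G (ULift.{v} ℤ)) : BurnsideGroup G :=
  burnsideClass (AlmostFinite.ofMult fun V => (x V).down.toNat) -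
    burnsideClass (AlmostFinite.ofMult fun V => (-(x V).down).toNat)

/-- The canonical map from the lifted integers to the integers. -/
abbrev downHom : ULift.{v} ℤ →+* ℤ := ULift.ringEquiv.toRingHom

theorem down_ghost (q : ℤ) (x : NrSet G (ULift.{v} ℤ)) (U : ConjClass G) :
    (ghost q x U).down = zmul q (fun V => (x V).down) U := by
  have h := map_zmul downHom (q : ULift.{v} ℤ) x U
  rw [map_intCast] at h
  exact h

theorem twistedMark_burnsideSum (q : ℤ) (x : NrSet G (ULift.{v} ℤ)) (U : OpenSubgroup G) :
    twistedMark q U (burnsideSum x) = (ghost q x (cls U)).down := by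
  rw [burnsideSum, map_sub, twistedMark_burnsideClass, twistedMark_burnsideClass,
    AlmostFinite.mark_ofMult, AlmostFinite.mark_ofMult, ← Pi.sub_apply, ← zmul_sub, down_ghost]
  refine congrFun (congrArg _ (funext fun V => ?_)) _
  exact Int.toNat_sub_toNat_neg _

theorem ghost_ulift_injective (q : ℤ) :
    Function.Injective (ghost q : NrSet G (ULift.{v} ℤ) → ConjClass G → ULift.{v} ℤ) :=
  ghost_injective q fun n hn a ha => by
    refine ULift.down_injective (int_mul_eq_zero n hn a.down ?_)
    exact congrArg ULift.down ha

theorem burnsideSum_injective :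
    Function.Injective (burnsideSum : NrSet G (ULift.{v} ℤ) → BurnsideGroup G) := by
  intro x y h
  refine ghost_ulift_injective 1 (funext fun U => ULift.down_injective ?_)
  rw [← cls_rep U, ← twistedMark_burnsideSum, ← twistedMark_burnsideSum, h]

theorem burnsideSum_surjective :
    Function.Surjective (burnsideSum : NrSet G (ULift.{v} ℤ) → BurnsideGroup G) := by
  intro a
  obtain ⟨X, Y, rfl⟩ := exists_burnsideClass_sub a
  obtain ⟨m, hm⟩ := AlmostFinite.exists_mark_eq X
  obtain ⟨n, hn⟩ := AlmostFinite.exists_mark_eq Y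
  let x : NrSet G (ULift.{v} ℤ) := fun V => ⟨m V - n V⟩
  refine ⟨x, twistedMark_injective 1 fun U => ?_⟩
  rw [twistedMark_burnsideSum, map_sub, twistedMark_burnsideClass, twistedMark_burnsideClass, hm,
    hn, down_ghost, ← Pi.sub_apply, ← zmul_sub]
  rfl

/-- The bijection `x ↦ ∑ x_V [G/V]`. -/
noncomputable def burnsideEquiv : NrSet G (ULift.{v} ℤ) ≃ BurnsideGroup G :=
  Equiv.ofBijective burnsideSum ⟨burnsideSum_injective, burnsideSum_surjective⟩

theorem twistedMark_burnsideEquiv (q : ℤ) (x : NrSet G (ULift.{v} ℤ)) (U : OpenSubgroup G) :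
    twistedMark q U (burnsideEquiv x) = (ghost q x (cls U)).down :=
  twistedMark_burnsideSum q x U

open Classical in
theorem zmul_single {R : Type*} [CommRing R] (q : R) (V U : ConjClass G) :
    zmul q (fun W => if W = V then 1 else 0) U = zeta q U V := by
  simp only [zmul, mul_ite, mul_one, mul_zero]
  by_cases h : Prec V U
  · rw [Finset.sum_eq_single ⟨V, h⟩]
    · rw [if_pos rfl]
    · intro W _ hW
      exact if_neg fun h' => hW (Subtype.ext h')
    · intro h'
      exact absurd (Finset.mem_univ _) h'
  · rw [zeta_eq_zero _ h]
    refine Finset.sum_eq_zero fun W _ => if_neg ?_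
    rintro rfl
    exact h W.2

theorem ghost_basisVec (q : ℤ) (A : Type v) [CommRing A] (V U : ConjClass G) :
    ghost q (basisVec A V) U = zeta (q : A) U V := zmul_single (q : A) V U

theorem coset_equiv_of_cls_eq {V W : OpenSubgroup G} (h : cls V = cls W) :
    AlmostFinite.coset V ≈ AlmostFinite.coset W := by
  obtain ⟨g, rfl⟩ := cls_eq_iff_conjOpen.1 h
  refine ⟨⟨Quotient.map' (· * g) fun a b hab => ?_, Quotient.map' (· * g⁻¹) fun a b hab => ?_,
    ?_, ?_⟩, ?_⟩
  · rw [QuotientGroup.leftRel_apply] at *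
    have := mem_conjOpen.1 hab
    simpa [mul_assoc] using this
  · rw [QuotientGroup.leftRel_apply] at *
    refine mem_conjOpen.2 ?_
    simpa [mul_assoc] using hab
  · intro x
    obtain ⟨a, rfl⟩ := AlmostFinite.cosetMk_surjective _ x
    exact congrArg (AlmostFinite.cosetMk _) (mul_inv_cancel_right a g)
  · intro x
    obtain ⟨a, rfl⟩ := AlmostFinite.cosetMk_surjective _ x
    exact congrArg (AlmostFinite.cosetMk _) (inv_mul_cancel_right a g)
  · intro h x
    obtain ⟨a, rfl⟩ := AlmostFinite.cosetMk_surjective _ x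
    exact congrArg (AlmostFinite.cosetMk _) (mul_assoc h a g)

theorem mark_coset (q : ℤ) (U V : OpenSubgroup G) :
    AlmostFinite.mark q U (AlmostFinite.coset V) = zeta q (cls U) (cls V) := by
  rw [← AlmostFinite.mark_coset_rep, AlmostFinite.mark_rep_cls]
  exact AlmostFinite.mark_congr q U _ _ (coset_equiv_of_cls_eq (cls_rep _).symm)

/-- The equation does not involve q, so comparing marks for q = 1 is enough. -/
theorem burnsideEquiv_basisVec (V : OpenSubgroup G) :
    burnsideEquiv (basisVec (ULift.{v} ℤ) (cls V)) = burnsideClass (AlmostFinite.coset V) := by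
  refine twistedMark_injective 1 fun U => ?_
  rw [twistedMark_burnsideEquiv, ghost_basisVec, twistedMark_burnsideClass, mark_coset]
  exact (map_zeta downHom _ _ _).trans (by rw [map_intCast]; rfl)

theorem IsTwistedBurnsideRing.unique {q : ℤ} {S T : NonUnitalCommRing (BurnsideGroup G)}
    (hS : IsTwistedBurnsideRing q S) (hT : IsTwistedBurnsideRing q T) : S = T := by
  refine NonUnitalCommRing.ext (funext fun a => funext fun b => ?_)
    (funext fun a => funext fun b => ?_)
  · exact twistedMark_injective q fun U => (hS U a b).1.trans (hT U a b).1.symm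
  · exact twistedMark_injective q fun U => (hS U a b).2.trans (hT U a b).2.symm

/-- The product of `Ω̂^q(G)`. -/
noncomputable def twistedMul (q : ℤ) (a b : BurnsideGroup G) : BurnsideGroup G :=
  burnsideEquiv.{u, 0} (necklaceMul q (burnsideEquiv.symm a) (burnsideEquiv.symm b))

theorem twistedMark_twistedMul (q : ℤ) (U : OpenSubgroup G) (a b : BurnsideGroup G) :
    twistedMark q U (twistedMul q a b) = twistedMark q U a * twistedMark q U b := by
  rw [twistedMul, twistedMark_burnsideEquiv, ghost_necklaceMul, Pi.mul_apply, ULift.mul_down,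
    ← twistedMark_burnsideEquiv, ← twistedMark_burnsideEquiv, Equiv.apply_symm_apply,
    Equiv.apply_symm_apply]

/-- The twisted Burnside ring `Ω̂^q(G)`. -/
@[reducible]
noncomputable def twistedBurnsideRing (q : ℤ) : NonUnitalCommRing (BurnsideGroup G) where
  toAddCommGroup := (inferInstance : AddCommGroup (BurnsideGroup G))
  mul := twistedMul q
  mul_assoc a b c := twistedMark_injective q fun U => by
    change twistedMark q U (twistedMul q (twistedMul q a b) c) =
      twistedMark q U (twistedMul q a (twistedMul q b c))
    simp only [twistedMark_twistedMul, mul_assoc]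
  mul_comm a b := twistedMark_injective q fun U => by
    change twistedMark q U (twistedMul q a b) = twistedMark q U (twistedMul q b a)
    simp only [twistedMark_twistedMul, mul_comm]
  left_distrib a b c := twistedMark_injective q fun U => by
    change twistedMark q U (twistedMul q a (b + c)) =
      twistedMark q U (twistedMul q a b + twistedMul q a c)
    simp only [twistedMark_twistedMul, map_add, mul_add]
  right_distrib a b c := twistedMark_injective q fun U => by
    change twistedMark q U (twistedMul q (a + b) c) =
      twistedMark q U (twistedMul q a c + twistedMul q b c)
    simp only [twistedMark_twistedMul, map_add, add_mul]
  zero_mul a := twistedMark_injective q fun U => by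
    change twistedMark q U (twistedMul q 0 a) = _
    rw [twistedMark_twistedMul, map_zero, zero_mul]
  mul_zero a := twistedMark_injective q fun U => by
    change twistedMark q U (twistedMul q a 0) = _
    rw [twistedMark_twistedMul, map_zero, mul_zero]

theorem isTwistedBurnsideRing_twistedBurnsideRing (q : ℤ) :
    IsTwistedBurnsideRing q (twistedBurnsideRing (G := G) q) :=
  fun U a b => ⟨map_add _ a b, twistedMark_twistedMul q U a b⟩

end Burnside

/-! ### The case q = 1: orbits on products of cosets and double cosets. -/

section Mackey

variable {G : Type u} [Group G] [TopologicalSpace G] [IsTopologicalGroup G] [CompactSpace G]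

open AlmostFinite

/-- Each orbit on G/V × G/W contains a point (V, gW), with g unique up to its double coset VgW; the
stabilizer of that point is V ∩ gWg⁻¹. -/
theorem prod_coset_equiv_ofMult (V W : ConjClass G) :
    (coset V.rep).prod (coset W.rep) ≈ ofMult (mackeyCount V W) := by
  let ρ (D : DoubleCoset.Quotient (V.rep : Set G) (W.rep : Set G)) :
      ((coset V.rep).prod (coset W.rep)).carrier :=
    (cosetMk V.rep 1, cosetMk W.rep (Quotient.out D))
  have hst (D) : ((coset V.rep).prod (coset W.rep)).stab (ρ D) =
      V.rep ⊓ conjOpen (Quotient.out D) W.rep := by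
    have h1 : (coset V.rep).stab (cosetMk V.rep 1) = V.rep := by rw [stab_cosetMk, conjOpen_one]
    refine Eq.trans ?_ (congrArg₂ (· ⊓ ·) h1 (stab_cosetMk W.rep (Quotient.out D)))
    ext g
    exact Prod.ext_iff
  have h := equiv_ofMult ρ ?_ ?_
  · simp only [hst] at h
    exact h
  · rintro ⟨x, y⟩
    obtain ⟨a, rfl⟩ := cosetMk_surjective _ x
    obtain ⟨b, rfl⟩ := cosetMk_surjective _ y
    obtain ⟨h, k, hh, hk, hout⟩ :=
      DoubleCoset.mk_out_eq_mul V.rep.toSubgroup W.rep.toSubgroup (a⁻¹ * b)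
    -- With representative h·a⁻¹b·k, the element ah⁻¹ carries (V, h a⁻¹b k W) to (aV, bW).
    refine ⟨DoubleCoset.mk _ _ (a⁻¹ * b), a * h⁻¹, Prod.ext ?_ ?_⟩
    · change cosetMk V.rep _ = _
      refine cosetMk_eq_iff.2 ?_
      simpa using hh
    · change cosetMk W.rep _ = _
      refine cosetMk_eq_iff.2 ?_
      have : (a * h⁻¹ * (DoubleCoset.mk V.rep.toSubgroup W.rep.toSubgroup (a⁻¹ * b)).out)⁻¹ * b =
          k⁻¹ := by
        rw [hout]
        group
      exact this ▸ inv_mem hk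
  · intro D E g hg
    have h1 := cosetMk_eq_iff.1 (congrArg Prod.fst hg)
    have h2 := cosetMk_eq_iff.1 (congrArg Prod.snd hg)
    have hg : g ∈ V.rep := by simpa using h1
    rw [← DoubleCoset.out_eq' V.rep.toSubgroup W.rep.toSubgroup D,
      ← DoubleCoset.out_eq' V.rep.toSubgroup W.rep.toSubgroup E, DoubleCoset.eq]
    exact ⟨g, hg, _, h2, (mul_inv_cancel_left _ _).symm⟩

/-- Both families solve the same system for `zmul 1`, one by construction and the other by counting
fixed points on G/V × G/W. -/
theorem structureInt_one (V W U : ConjClass G) : structureInt 1 V W U = mackeyCount V W U := by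
  refine congrFun (zmul_injective int_mul_eq_zero 1 (a₁ := structureInt 1 V W)
    (a₂ := fun U => (mackeyCount V W U : ℤ)) (funext fun Z => ?_)) U
  have h := congrFun (zmul_structureInt 1 V W) Z
  refine h.trans ?_
  rw [← cls_rep Z, ← mark_ofMult, ← mark_congr _ _ _ _ (prod_coset_equiv_ofMult V W),
    mark_one_prod, mark_coset_rep, mark_coset_rep, cls_rep]

end Mackey
-- The unit for q = 1 and the assembly of the theorem.
section Main

variable {G : Type u} [Group G] [TopologicalSpace G]

theorem map_basisVec {A B : Type v} [CommRing A] [CommRing B] (f : A →+* B) (V : ConjClass G) :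
    NrSet.map f (basisVec A V) = basisVec B V := by
  funext U
  simp [NrSet.map, basisVec, apply_ite f]

variable [IsTopologicalGroup G] [CompactSpace G]

/-- G/G is a single point, fixed by every U, and for q = 1 the powers of q are trivial. -/
theorem ghost_basisVec_top (A : Type v) [CommRing A] :
    ghost 1 (basisVec A (cls (⊤ : OpenSubgroup G))) = 1 := by
  funext U
  have h : zeta (1 : ℤ) U (cls (⊤ : OpenSubgroup G)) = 1 := by
    rw [← cls_rep U, ← mark_coset, AlmostFinite.mark_one_left]
    have : Nat.card (MulAction.fixedPoints U.rep.toSubgroup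
        (AlmostFinite.coset (⊤ : OpenSubgroup G)).carrier) = 1 := by
      refine Nat.card_eq_one_iff_unique.2 ⟨⟨fun x y => Subtype.ext ?_⟩,
        ⟨⟨AlmostFinite.cosetMk ⊤ 1, fun g => AlmostFinite.cosetMk_eq_iff.2 trivial⟩⟩⟩
      obtain ⟨a, ha⟩ := AlmostFinite.cosetMk_surjective _ x.1
      obtain ⟨b, hb⟩ := AlmostFinite.cosetMk_surjective _ y.1
      rw [← ha, ← hb]
      exact AlmostFinite.cosetMk_eq_iff.2 trivial
    rw [this, Nat.cast_one]
  have h' := map_zeta (Int.castRingHom A) 1 U (cls (⊤ : OpenSubgroup G))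
  rw [h, map_one] at h'
  rw [ghost_basisVec, Int.cast_one, Pi.one_apply]
  exact h'.symm

theorem basisVec_top_necklaceMul {A : Type v} [CommRing A] (x : NrSet G A) :
    necklaceMul 1 (basisVec A (cls (⊤ : OpenSubgroup G))) x = x := by
  obtain ⟨x, rfl⟩ := exists_cover x
  rw [← map_basisVec (Cover.eval A), ← map_necklaceMul]
  refine congrArg _ (ghost_cover_injective 1 A ?_)
  rw [ghost_necklaceMul, ghost_basisVec_top, one_mul]

end Main
end QNecklace

theorem mainTheorem3 (G : Type u) [Group G] [TopologicalSpace G] [IsTopologicalGroup G]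
    [CompactSpace G] [T2Space G] [TotallyDisconnectedSpace G] (q : ℤ) :
    (∃! S : ∀ (A : Type v) [CommRing A], NonUnitalCommRing (QNecklace.NrSet G A),
      QNecklace.IsNecklaceFunctor q S) ∧
    (∃! T : NonUnitalCommRing (QNecklace.BurnsideGroup G),
      QNecklace.IsTwistedBurnsideRing q T) ∧
    ∀ S : ∀ (A : Type v) [CommRing A], NonUnitalCommRing (QNecklace.NrSet G A),
      QNecklace.IsNecklaceFunctor q S →
      -- the addition is componentwise
      (∀ (A : Type v) [CommRing A] (x y : QNecklace.NrSet G A) (U : QNecklace.ConjClass G),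
        (x + y) U = x U + y U) ∧
      -- the structure constants of the product are the values `P_{V,W}^U(q)`, which are integers
      (∃ p : QNecklace.ConjClass G → QNecklace.ConjClass G → QNecklace.ConjClass G → ℤ,
        (∀ U V W : QNecklace.ConjClass G, QNecklace.Prec V U → QNecklace.Prec W U →
          (p V W U : ℚ) = (QNecklace.structurePoly V W U).eval (q : ℚ)) ∧
        ∀ (A : Type v) [CommRing A] (x y : QNecklace.NrSet G A) (U : QNecklace.ConjClass G),
          (x * y) U = ∑ V : QNecklace.Below U, ∑ W : QNecklace.Below U,
            (p V.1 W.1 U : A) * (x V.1 * y W.1)) ∧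
      -- for `q = 1` it is the necklace ring, with its unit and the Mackey product
      (q = 1 → ∀ (A : Type v) [CommRing A] (x y : QNecklace.NrSet G A),
        QNecklace.basisVec A (QNecklace.cls (⊤ : OpenSubgroup G)) * x = x ∧
        ∀ U : QNecklace.ConjClass G,
          (x * y) U = ∑ V : QNecklace.Below U, ∑ W : QNecklace.Below U,
            (QNecklace.mackeyCount V.1 W.1 U : A) * (x V.1 * y W.1)) ∧
      -- over the integers it is the twisted Burnside ring
      (∀ T : NonUnitalCommRing (QNecklace.BurnsideGroup G),
        QNecklace.IsTwistedBurnsideRing q T →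
        (∀ a b : QNecklace.BurnsideGroup G, T.add a b = QNecklace.burnsideAdd a b) ∧
        (∃ e : QNecklace.NrSet G (ULift.{v} ℤ) ≃ QNecklace.BurnsideGroup G,
          (∀ x y, e (x + y) = T.add (e x) (e y)) ∧
          (∀ x y, e (x * y) = T.mul (e x) (e y)) ∧
          (∀ V : OpenSubgroup G, e (QNecklace.basisVec (ULift.{v} ℤ) (QNecklace.cls V)) =
            QNecklace.burnsideClass (QNecklace.AlmostFinite.coset V)) ∧
          ∀ (x : QNecklace.NrSet G (ULift.{v} ℤ)) (U : OpenSubgroup G),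
            QNecklace.twistedMark q U (e x) = (QNecklace.ghost q x (QNecklace.cls U)).down) ∧
        (∀ n : ℕ, 0 < n → q = n → ∀ (U : OpenSubgroup G) (X : QNecklace.AlmostFinite G),
          QNecklace.twistedMark q U (QNecklace.burnsideClass X) =
            (X.colouredCount n U : ℤ)) ∧
        (q = 1 → ∀ X Y : QNecklace.AlmostFinite G,
          T.mul (QNecklace.burnsideClass X) (QNecklace.burnsideClass Y) =
            QNecklace.burnsideClass (X.prod Y))) := by
  refine ⟨QNecklace.existsUnique_isNecklaceFunctor q,
    ⟨_, QNecklace.isTwistedBurnsideRing_twistedBurnsideRing q, fun T hT =>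
      hT.unique (QNecklace.isTwistedBurnsideRing_twistedBurnsideRing q)⟩, fun S hS => ?_⟩
  -- By uniqueness S is the constructed functor, whose sum and product formulas hold by definition.
  obtain rfl := hS.unique (QNecklace.isNecklaceFunctor_necklaceRing q)
  refine ⟨fun _ _ _ _ _ => rfl, ⟨QNecklace.structureInt q, fun U V W _ _ =>
    QNecklace.structureInt_cast q V W U, fun _ _ _ _ _ => rfl⟩, ?_, fun T hT => ⟨?_, ?_, ?_, ?_⟩⟩
  · rintro rfl A _ x y
    refine ⟨QNecklace.basisVec_top_necklaceMul x, fun U => ?_⟩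
    refine Finset.sum_congr rfl fun V _ => Finset.sum_congr rfl fun W _ => ?_
    rw [QNecklace.structureInt_one, Int.cast_natCast]
  · exact fun a b => QNecklace.twistedMark_injective q fun U =>
      (hT U a b).1.trans (map_add (QNecklace.twistedMark q U) a b).symm
  · refine ⟨QNecklace.burnsideEquiv, fun x y => QNecklace.twistedMark_injective q fun U => ?_,
      fun x y => QNecklace.twistedMark_injective q fun U => ?_, QNecklace.burnsideEquiv_basisVec,
      QNecklace.twistedMark_burnsideEquiv q⟩
    · rw [(hT U _ _).1, QNecklace.twistedMark_burnsideEquiv, QNecklace.twistedMark_burnsideEquiv,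
        QNecklace.twistedMark_burnsideEquiv, hS.ghost_add, Pi.add_apply, ULift.add_down]
    · rw [(hT U _ _).2, QNecklace.twistedMark_burnsideEquiv, QNecklace.twistedMark_burnsideEquiv,
        QNecklace.twistedMark_burnsideEquiv, hS.ghost_mul, Pi.mul_apply, ULift.mul_down]
  · rintro n hn rfl U X
    have : NeZero n := ⟨hn.ne'⟩
    rw [QNecklace.twistedMark_burnsideClass, QNecklace.AlmostFinite.mark_eq_colouredCount]
  · rintro rfl X Y
    refine QNecklace.twistedMark_injective 1 fun U => ?_
    rw [(hT U _ _).2, QNecklace.twistedMark_burnsideClass, QNecklace.twistedMark_burnsideClass,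
      QNecklace.twistedMark_burnsideClass, QNecklace.AlmostFinite.mark_one_prod]
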